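/- A \emph{graphing} is a quadruple $\mathbf G=(\Omega,\mathcal B,\mu,E)$, where $(\Omega,\mathcal B)$ is a standard Borel space, $E\subseteq\Omega\times\Omega$ is a symmetric Borel set without loops $(x,x)$, all of whose vertex degrees are bounded by a finite constant, and $\mu$ is a probability measure on $(\Omega,\mathcal B)$ such that $\int_A d_B(x)\,d\mu(x)=\int_B d_A(x)\,d\mu(x)$ for all $A,B\in\mathcal B$, where $d_B(x)$ is the number of neighbours of $x$ in $B$. We view $E$ as a set of unordered pairs, with the $\sigma$-algebra $\mathcal B_E$ of the symmetric Borel subsets of $E$. The (normalized) cycle-matroid rank function of $\mathbf G$ is $$\rho_{\mathbf G}(F)=\int_\Omega\Bigl(1-\frac1{|\mathbf G[F]_x|}\Bigr)d\mu(x),\qquad F\in\mathcal B_E,$$ where $|\mathbf G[F]_x|$ is the number of vertices of the connected component of $x$ in $(\Omega,F)$ and $1/\infty=0$. A finite graph $G=(V,E)$ is regarded as a graphing with all subsets of $V$ measurable and $\mu(S)=|S|/|V|$. For a real-valued function $\varphi$ on the measurable subsets of a measurable space $J$ and $k\ge1$, let $\mathcal Q_k(\varphi)\subseteq\mathbb R^{2^k}$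 be the set of all points $(\varphi(P^{-1}(A)))_{A\subseteq[k]}$, where $P\colon J\to[k]$ is measurable. A sequence $(\varphi_i)$ of such set functions, on possibly different measurable spaces, is \emph{quotient convergent} if for every $k\ge1$ the sets $\mathcal Q_k(\varphi_i)$ converge, as $i\to\infty$, to some subset of $\mathbb R^{2^k}$ in the Hausdorff distance (with respect to the Euclidean metric), and it \emph{quotient converges to} a set function $\varphi$ if for every $k\ge1$ the Hausdorff distance between $\mathcal Q_k(\varphi_i)$ and $\mathcal Q_k(\varphi)$ tends to $0$. \textbf{Theorem.} Let $D\ge1$ be an integer and let $(G_i)_{i\ge1}$ be a sequence of finite connected graphs with maximum degree at most $D$. Let $\rho_i$ be the rank function of the cycle matroid of $G_i$ as a graphing. If $(\rho_i)$ is quotient convergent, then there exists a graphing $\mathbf G$, with all degrees at most $D$, such that $(\rho_i)$ quotient converges to $\rho_{\mathbf G}$. -/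

import Mathlib

open MeasureTheory Filter Topology
open scoped ENNReal

/-- A graphing: a symmetric, loopless Borel edge set of bounded degree on a standard Borel space,
together with an involution invariant probability measure. -/
structure Graphing where
  /-- the vertex set -/
  Ω : Type*
  [measurableSpace : MeasurableSpace Ω]
  [standardBorel : StandardBorelSpace Ω]
  /-- the adjacency relation (symmetric and irreflexive) -/
  graph : SimpleGraph Ω
  measurableSet_adj : MeasurableSet {p : Ω × Ω | graph.Adj p.1 p.2}
  bounded_degree : ∃ D : ℕ, ∀ x, (graph.neighborSet x).encard ≤ D
  /-- the probability measure on the vertex set -/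
  μ : Measure Ω
  [isProbabilityMeasure : IsProbabilityMeasure μ]
  /-- involution invariance; `(graph.neighborSet x ∩ B).encard` is the degree of `x` in `B` -/
  involution_invariant : ∀ A B : Set Ω, MeasurableSet A → MeasurableSet B →
    ∫⁻ x in A, ((graph.neighborSet x ∩ B).encard : ℝ≥0∞) ∂μ =
      ∫⁻ x in B, ((graph.neighborSet x ∩ A).encard : ℝ≥0∞) ∂μ

attribute [instance] Graphing.measurableSpace Graphing.standardBorel Graphing.isProbabilityMeasure

namespace Graphing

/-- The set of (undirected) edges of a graphing. -/
abbrev Edge (G : Graphing) : Type _ := G.graph.edgeSet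

/-- The σ-algebra on the edge set: the unordered pairs are the quotient of `Ω × Ω` by swapping the
coordinates and carry the quotient σ-algebra, so that measurable sets of unordered pairs are exactly
the symmetric Borel subsets of `Ω × Ω`; the edge set carries the restriction of it. -/
instance (G : Graphing) : MeasurableSpace G.Edge :=
  MeasurableSpace.comap (Subtype.val : G.Edge → Sym2 G.Ω)
    (MeasurableSpace.map (fun p : G.Ω × G.Ω => s(p.1, p.2)) inferInstance)

/-- The vertex set of the connected component of `x` in the spanning subgraph with edge set `F`. -/
def component (G : Graphing) (F : Set G.Edge) (x : G.Ω) : Set G.Ω :=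
  {y | (SimpleGraph.fromEdgeSet (Subtype.val '' F)).Reachable x y}

/-- The (normalized) rank function of the cycle matroid of a graphing,
`ρ(F) = ∫ (1 - 1 / |G[F]_x|) dμ(x)`; it is meant for measurable `F` only.
An infinite component contributes `1 / ∞ = 0`: its `Set.ncard` is `0` and `(0 : ℝ)⁻¹ = 0`,
and a component is never empty since it contains `x`. -/
noncomputable def rank (G : Graphing) (F : Set G.Edge) : ℝ :=
  ∫ x, (1 - ((G.component F x).ncard : ℝ)⁻¹) ∂G.μ

end Graphing

theorem SimpleGraph.setLIntegral_degree_uniform {V : Type*} [Fintype V] [MeasurableSpace V]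
    [DiscreteMeasurableSpace V] (G : SimpleGraph V) (c : ℝ≥0∞) (A B : Set V) :
    ∫⁻ x in A, ((G.neighborSet x ∩ B).encard : ℝ≥0∞) ∂(c • (Measure.count : Measure V)) =
      ∫⁻ x in B, ((G.neighborSet x ∩ A).encard : ℝ≥0∞) ∂(c • (Measure.count : Measure V)) := by
  classical
  have key : ∀ A B : Set V, ∫⁻ x in A, ((G.neighborSet x ∩ B).encard : ℝ≥0∞)
      ∂(c • (Measure.count : Measure V)) =
      c * ∑ x, ∑ y, if x ∈ A ∧ y ∈ B ∧ G.Adj x y then 1 else 0 := by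
    intro A B
    rw [← lintegral_indicator (MeasurableSet.of_discrete), lintegral_smul_measure,
      lintegral_count, tsum_fintype, smul_eq_mul]
    congr 1
    refine Finset.sum_congr rfl fun x _ => ?_
    by_cases hx : x ∈ A
    · have : G.neighborSet x ∩ B = ((Finset.univ.filter fun y => y ∈ B ∧ G.Adj x y : Finset V)) := by
        ext y; simp [and_comm]
      rw [Set.indicator_of_mem hx, this, Set.encard_coe_eq_coe_finsetCard]
      simp [hx]
    · simp [hx]
  rw [key, key, Finset.sum_comm]
  congr 1
  refine Finset.sum_congr rfl fun x _ => Finset.sum_congr rfl fun y _ => ?_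
  simp only [G.adj_comm x y]
  congr 1
  exact propext (by tauto)

/-- A finite graph as a graphing: all vertex sets are Borel and the measure is the uniform one,
`μ(S) = |S| / |V|`. -/
noncomputable def SimpleGraph.toGraphing {V : Type*} [Fintype V] [Nonempty V] (G : SimpleGraph V) :
    Graphing :=
  letI : MeasurableSpace V := ⊤
  haveI : DiscreteMeasurableSpace V := ⟨fun _ => trivial⟩
  { Ω := V
    graph := G
    measurableSet_adj := MeasurableSet.of_discrete
    bounded_degree := ⟨Fintype.card V, fun x => by
      refine (Set.encard_le_encard (Set.subset_univ _)).trans ?_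
      simp [Set.encard_univ]⟩
    μ := (Fintype.card V : ℝ≥0∞)⁻¹ • Measure.count
    isProbabilityMeasure := ⟨by
      simp [Measure.count_apply, Set.encard_univ, ENNReal.inv_mul_cancel]⟩
    involution_invariant := fun A B _ _ => G.setLIntegral_degree_uniform _ A B }

/-- The set `𝒬_k(φ)` of `k`-quotients `φ ∘ P⁻¹`, with `P : J → [k]` measurable, of a set function `φ`
on the measurable subsets of `J`, as a set of points of `ℝ ^ (2 ^ k)` with the Euclidean metric.
Only the values of `φ` on measurable sets enter. -/
def quotientSet {J : Type*} [MeasurableSpace J] (k : ℕ) (φ : Set J → ℝ) :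
    Set (EuclideanSpace ℝ (Finset (Fin k))) :=
  {v | ∃ P : J → Fin k, Measurable P ∧ ∀ A : Finset (Fin k), v A = φ (P ⁻¹' (A : Set (Fin k)))}

/-- `φ_i` quotient converges to `ψ`: for each `k ≥ 1` the sets of `k`-quotients converge in the
Hausdorff distance. -/
def QuotientConvergesTo {J : ℕ → Type*} [∀ i, MeasurableSpace (J i)] {J' : Type*}
    [MeasurableSpace J'] (φ : ∀ i, Set (J i) → ℝ) (ψ : Set J' → ℝ) : Prop :=
  ∀ k : ℕ, 1 ≤ k →
    Tendsto (fun i => Metric.hausdorffEDist (quotientSet k (φ i)) (quotientSet k ψ)) atTop (𝓝 0)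

/-- `φ_i` is quotient convergent: for each `k ≥ 1` the sets of `k`-quotients converge in the
Hausdorff distance to some set, which is not required to come from a set function. -/
def QuotientConvergent {J : ℕ → Type*} [∀ i, MeasurableSpace (J i)]
    (φ : ∀ i, Set (J i) → ℝ) : Prop :=
  ∀ k : ℕ, 1 ≤ k → ∃ A : Set (EuclideanSpace ℝ (Finset (Fin k))),
    Tendsto (fun i => Metric.hausdorffEDist (quotientSet k (φ i)) A) atTop (𝓝 0)

/-! A proper edge colouring with `2 * D + 1` colours turns each finite graph into a system of
involutions `a i j`, each edge being a step of exactly one of them. Components become clusters of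
walks, and a measurable colouring of the edges becomes a symmetric colouring of the steps
(`mem_quotientSet_iff`).

For each `k`, fix a countable dense subset of the limit of the sets of quotients, and write each of
its points as a limit of quotients of the finite graphs. The colourings producing these quotients,
together with three-colourings telling words apart, are labels on the vertices. Recording the labels
of all points reached by words embeds the dynamics of all the graphs in one compact, totally
disconnected space `K` on which the involutions act by shifts (`exists_compactification`). There
each label is continuous, and two words agree on a clopen set. The images of the uniform measures
have an invariant weak limit `μ` along an ultrafilter, and the involutions on `(K, μ)` generate the
limit graphing.

The rank passes to the limit because it is almost local: replacing a cluster by its ball of radius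
`r` changes the reciprocal size by at most `1 / (r + 1)`, and for clopen sets of allowed steps the
ball size is locally constant. Hence ranks of continuous colourings converge
(`tendsto_clusterRank`).

Each chosen dense point is thus exactly a quotient of the limit, given by its own labels.
Conversely, a measurable colouring of the limit is approximated by continuous symmetric ones
(`exists_continuous_colouring`), which pull back to the finite graphs, so its quotient lies in the
closure of the limit set. The two closures agree, and the Hausdorff distance sees only closures. -/

/-! ### Words in self-maps, clusters and their balls -/

section Words

variable {ι Ω Ω' : Type*}

/-- The action of a word in the generators `s`; the first letter acts first. -/
def wordAct (s : ι → Ω → Ω) : List ι → Ω → Ω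
  | [], x => x
  | j :: w, x => wordAct s w (s j x)

/-- The walk from `x` following the word is allowed, where `x ∈ O j` means that the step
`x ↦ s j x` is allowed. -/
def OpenWord (s : ι → Ω → Ω) (O : ι → Set Ω) : List ι → Ω → Prop
  | [], _ => True
  | j :: w, x => x ∈ O j ∧ OpenWord s O w (s j x)

/-- The points reached from `x` by allowed walks. -/
def cluster (s : ι → Ω → Ω) (O : ι → Set Ω) (x : Ω) : Set Ω :=
  {y | ∃ w, OpenWord s O w x ∧ wordAct s w x = y}

/-- The points reached from `x` by allowed walks of length at most `r`. -/
def clusterBall (s : ι → Ω → Ω) (O : ι → Set Ω) (r : ℕ) (x : Ω) : Set Ω :=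
  {y | ∃ w, w.length ≤ r ∧ OpenWord s O w x ∧ wordAct s w x = y}

variable {s : ι → Ω → Ω} {O : ι → Set Ω}

theorem wordAct_append (w w' : List ι) (x : Ω) :
    wordAct s (w ++ w') x = wordAct s w' (wordAct s w x) := by
  induction w generalizing x with
  | nil => rfl
  | cons j w ih => exact ih _

theorem openWord_append (w w' : List ι) (x : Ω) :
    OpenWord s O (w ++ w') x ↔ OpenWord s O w x ∧ OpenWord s O w' (wordAct s w x) := by
  induction w generalizing x with
  | nil => simp [OpenWord, wordAct]
  | cons j w ih => simp [OpenWord, wordAct, ih, and_assoc]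

theorem wordAct_map {s' : ι → Ω' → Ω'} {f : Ω → Ω'} (h : ∀ j x, f (s j x) = s' j (f x))
    (w : List ι) (x : Ω) : f (wordAct s w x) = wordAct s' w (f x) := by
  induction w generalizing x with
  | nil => rfl
  | cons j w ih => simp only [wordAct, ih, h]

theorem openWord_map {s' : ι → Ω' → Ω'} {O' : ι → Set Ω'} {f : Ω → Ω'}
    (h : ∀ j x, f (s j x) = s' j (f x)) (hO : ∀ j x, x ∈ O j ↔ f x ∈ O' j)
    (w : List ι) (x : Ω) : OpenWord s O w x ↔ OpenWord s' O' w (f x) := by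
  induction w generalizing x with
  | nil => rfl
  | cons j w ih => simp only [OpenWord, ih, h, hO]

theorem clusterBall_subset_cluster (r : ℕ) (x : Ω) : clusterBall s O r x ⊆ cluster s O x :=
  fun _ ⟨w, _, h⟩ => ⟨w, h⟩

theorem self_mem_clusterBall (r : ℕ) (x : Ω) : x ∈ clusterBall s O r x :=
  ⟨[], by simp, trivial, rfl⟩

theorem clusterBall_mono {r r' : ℕ} (h : r ≤ r') (x : Ω) :
    clusterBall s O r x ⊆ clusterBall s O r' x :=
  fun _ ⟨w, hw, hy⟩ => ⟨w, hw.trans h, hy⟩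

theorem mem_clusterBall_succ {r : ℕ} {x y : Ω} {j : ι} (hy : y ∈ clusterBall s O r x)
    (hj : y ∈ O j) : s j y ∈ clusterBall s O (r + 1) x := by
  obtain ⟨w, hw, ho, rfl⟩ := hy
  refine ⟨w ++ [j], by simpa using hw, ?_, ?_⟩
  · rw [openWord_append]
    exact ⟨ho, hj, trivial⟩
  · rw [wordAct_append]
    rfl

theorem cluster_subset_of_closed {S : Set Ω} {x : Ω} (hx : x ∈ S)
    (hS : ∀ y ∈ S, ∀ j, y ∈ O j → s j y ∈ S) : cluster s O x ⊆ S := by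
  rintro _ ⟨w, ho, rfl⟩
  induction w generalizing x with
  | nil => exact hx
  | cons j w ih => exact ih (hS x hx j ho.1) ho.2

/-- A ball that does not grow in one more step is closed under allowed steps. -/
theorem cluster_eq_clusterBall {r : ℕ} {x : Ω}
    (h : clusterBall s O (r + 1) x = clusterBall s O r x) :
    cluster s O x = clusterBall s O r x :=
  (cluster_subset_of_closed (self_mem_clusterBall r x) fun _ hy _ hj =>
    h ▸ mem_clusterBall_succ hy hj).antisymm (clusterBall_subset_cluster r x)

theorem clusterBall_eq_image (r : ℕ) (x : Ω) :
    clusterBall s O r x =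
      (fun w => wordAct s w x) '' {w : List ι | w.length ≤ r ∧ OpenWord s O w x} := by
  ext y
  simp [clusterBall, and_assoc]

/-- The size of a ball in a cluster depends only on which short words are allowed and which short
words act in the same way. -/
theorem ncard_clusterBall_congr {s' : ι → Ω' → Ω'} {O' : ι → Set Ω'} {r : ℕ} {x : Ω} {x' : Ω'}
    (ho : ∀ w : List ι, w.length ≤ r → (OpenWord s O w x ↔ OpenWord s' O' w x'))
    (he : ∀ w w' : List ι, w.length ≤ r → w'.length ≤ r →
      (wordAct s w x = wordAct s w' x ↔ wordAct s' w x' = wordAct s' w' x')) :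
    (clusterBall s O r x).ncard = (clusterBall s' O' r x').ncard := by
  -- Each point of the ball gets one short allowed word leading to it; the bijection follows the
  -- same word from `x'`.
  choose! g hg using fun y (hy : y ∈ clusterBall s O r x) => hy
  refine Set.ncard_congr (fun y _ => wordAct s' (g y) x') ?_ ?_ ?_
  · intro y hy
    exact ⟨g y, (hg y hy).1, (ho _ (hg y hy).1).1 (hg y hy).2.1, rfl⟩
  · intro y z hy hz h
    rw [← he _ _ (hg y hy).1 (hg z hz).1, (hg y hy).2.2, (hg z hz).2.2] at h
    exact h
  · rintro _ ⟨w, hw, hw', rfl⟩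
    have hm : wordAct s w x ∈ clusterBall s O r x := ⟨w, hw, (ho w hw).2 hw', rfl⟩
    refine ⟨_, hm, ?_⟩
    rw [← he _ _ (hg _ hm).1 hw]
    exact (hg _ hm).2.2

theorem openWord_congr {O' : ι → Set Ω} {r : ℕ} {x : Ω}
    (h : ∀ w : List ι, w.length ≤ r → ∀ j, wordAct s w x ∈ O j ↔ wordAct s w x ∈ O' j)
    (w : List ι) (hw : w.length ≤ r) : OpenWord s O w x ↔ OpenWord s O' w x := by
  induction w generalizing x r with
  | nil => rfl
  | cons j w ih =>
    obtain ⟨r, rfl⟩ : ∃ r', r = r' + 1 := ⟨r - 1, by simp at hw; lia⟩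
    refine and_congr (h [] (by simp) j) (ih (r := r) (fun w' hw' => h (j :: w') ?_) ?_)
    · simpa using hw'
    · simpa using hw

variable [Finite ι]

theorem finite_clusterBall (r : ℕ) (x : Ω) : (clusterBall s O r x).Finite := by
  rw [clusterBall_eq_image]
  exact ((List.finite_length_le ι r).subset fun w hw => hw.1).image _

theorem ncard_clusterBall_pos (r : ℕ) (x : Ω) : 0 < (clusterBall s O r x).ncard :=
  (Set.ncard_pos (finite_clusterBall r x)).2 ⟨x, self_mem_clusterBall r x⟩

/-- Until the cluster is exhausted, each unit of radius adds at least one point. -/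
theorem lt_ncard_clusterBall {r : ℕ} {x : Ω} (h : cluster s O x ≠ clusterBall s O r x) :
    r < (clusterBall s O r x).ncard := by
  suffices ∀ m ≤ r, m < (clusterBall s O m x).ncard from this r le_rfl
  intro m
  induction m with
  | zero => exact fun _ => ncard_clusterBall_pos 0 x
  | succ m ih =>
    intro hm
    refine (Nat.succ_le_of_lt (ih (by lia))).trans_lt ?_
    refine Set.ncard_lt_ncard (LE.le.ssubset_of_ne (clusterBall_mono m.le_succ x) ?_)
      (finite_clusterBall _ x)
    intro he
    have hc := cluster_eq_clusterBall he.symm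
    refine h ((hc.trans_subset (clusterBall_mono (by lia) x)).antisymm ?_)
    exact clusterBall_subset_cluster r x

/-- Unless ball and cluster coincide, both have more than `r` points, so both reciprocals lie in
`[0, 1 / (r + 1)]`; an infinite cluster has reciprocal `0`. The uniformity in `x` makes the rank
almost local. -/
theorem abs_inv_ncard_clusterBall_sub_le (r : ℕ) (x : Ω) :
    |((clusterBall s O r x).ncard : ℝ)⁻¹ - ((cluster s O x).ncard : ℝ)⁻¹| ≤ ((r : ℝ) + 1)⁻¹ := by
  by_cases h : cluster s O x = clusterBall s O r x
  · rw [h, sub_self, abs_zero]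
    positivity
  have h1 : (r : ℝ) + 1 ≤ (clusterBall s O r x).ncard := mod_cast lt_ncard_clusterBall h
  have h2 : ((clusterBall s O r x).ncard : ℝ)⁻¹ ≤ ((r : ℝ) + 1)⁻¹ := by gcongr
  have h3 : ((cluster s O x).ncard : ℝ)⁻¹ ≤ ((r : ℝ) + 1)⁻¹ := by
    by_cases hf : (cluster s O x).Finite
    · have : ((clusterBall s O r x).ncard : ℝ) ≤ (cluster s O x).ncard :=
        mod_cast Set.ncard_le_ncard (clusterBall_subset_cluster r x) hf
      gcongr
      exact h1.trans this
    · rw [Set.Infinite.ncard hf]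
      simp only [Nat.cast_zero, inv_zero]
      positivity
  rw [abs_sub_le_iff]
  constructor
  · have : (0 : ℝ) ≤ ((cluster s O x).ncard : ℝ)⁻¹ := by positivity
    linarith
  · have : (0 : ℝ) ≤ ((clusterBall s O r x).ncard : ℝ)⁻¹ := by positivity
    linarith

end Words

/-! ### Greedy colourings and involutions from edge colourings -/

section Colouring

theorem SimpleGraph.exists_greedy_colouring {V : Type*} [Finite V] (G : SimpleGraph V) {d : ℕ}
    (hd : ∀ v, (G.neighborSet v).encard ≤ d) :
    ∃ c : V → Fin (d + 1), ∀ v w, G.Adj v w → c v ≠ c w := by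
  classical
  have := Fintype.ofFinite V
  suffices ∀ S : Finset V, ∃ c : V → Fin (d + 1), ∀ v ∈ S, ∀ w ∈ S, G.Adj v w → c v ≠ c w by
    obtain ⟨c, hc⟩ := this Finset.univ
    exact ⟨c, fun v w => hc v (Finset.mem_univ _) w (Finset.mem_univ _)⟩
  intro S
  induction S using Finset.induction_on with
  | empty => exact ⟨0, by simp⟩
  | insert a S _ ih =>
    obtain ⟨c, hc⟩ := ih
    obtain ⟨t, ht⟩ : ∃ t : Fin (d + 1), t ∉ c '' G.neighborSet a := by
      by_contra! h
      have h1 : (Set.univ : Set (Fin (d + 1))).encard ≤ d :=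
        (Set.encard_le_encard fun t _ => h t).trans ((Set.encard_image_le _ _).trans (hd a))
      rw [Set.encard_univ, ENat.card_eq_coe_fintype_card, Fintype.card_fin] at h1
      exact absurd (Nat.cast_le.1 h1) (by lia)
    have hta : ∀ w, G.Adj a w → t ≠ c w := fun w hw h => ht ⟨w, hw, h.symm⟩
    refine ⟨Function.update c a t, fun v hv w hw hvw => ?_⟩
    rcases eq_or_ne v a with rfl | hva
    · rw [Function.update_self, Function.update_of_ne hvw.ne']
      exact hta w hvw
    rcases eq_or_ne w a with rfl | hwa
    · rw [Function.update_self, Function.update_of_ne hva]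
      exact (hta v hvw.symm).symm
    rw [Function.update_of_ne hva, Function.update_of_ne hwa]
    exact hc v (Finset.mem_of_mem_insert_of_ne hv hva) w (Finset.mem_of_mem_insert_of_ne hw hwa) hvw

/-- Joining `v` to `p v` gives a graph of degree at most two, with neighbours among `p v` and
`p.symm v`. -/
theorem Equiv.Perm.exists_three_colouring {V : Type*} [Finite V] (p : Equiv.Perm V) :
    ∃ c : V → Fin 3, ∀ v, p v ≠ v → c (p v) ≠ c v := by
  obtain ⟨c, hc⟩ := (SimpleGraph.fromRel fun v w => p v = w).exists_greedy_colouring (d := 2) (by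
    intro v
    have : (SimpleGraph.fromRel fun v w => p v = w).neighborSet v ⊆ {p v, p.symm v} := by
      rintro w ⟨_, h | h⟩
      · exact Or.inl h.symm
      · exact Or.inr (by simp [← h])
    refine (Set.encard_le_encard this).trans ((Set.encard_insert_le _ _).trans ?_)
    rw [Set.encard_singleton]
    exact le_of_eq one_add_one_eq_two)
  exact ⟨c, fun v hv => hc _ _ (by simpa using hv)⟩

/-- The words `w` and `w'` can be told apart by three colours. -/
theorem exists_colouring_wordAct {ι V : Type*} [Finite V] {a : ι → V → V}
    (ha : ∀ j, Function.Bijective (a j)) (w w' : List ι) :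
    ∃ c : V → Fin 3, ∀ v, wordAct a w v ≠ wordAct a w' v →
      c (wordAct a w v) ≠ c (wordAct a w' v) := by
  have hb : ∀ w : List ι, Function.Bijective (wordAct a w) := by
    intro w
    induction w with
    | nil => exact Function.bijective_id
    | cons j w ih => exact ih.comp (ha j)
  let p := Equiv.ofBijective _ (hb w)
  let q := Equiv.ofBijective _ (hb w')
  obtain ⟨c, hc⟩ := Equiv.Perm.exists_three_colouring (q.symm.trans p)
  refine ⟨c, fun v hv => ?_⟩
  -- The coloured permutation carries the endpoint of `w'` to the endpoint of `w`.
  have h : (q.symm.trans p) (wordAct a w' v) = wordAct a w v := by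
    change p (q.symm (q v)) = p v
    rw [q.symm_apply_apply]
  simpa only [h] using hc (wordAct a w' v) (by rwa [h])

/-- Greedy colouring of the line graph: at most `D` edges meet each end of an edge, so its degrees
are at most `2 * D`. -/
theorem SimpleGraph.exists_edge_colouring {V : Type*} [Finite V] (G : SimpleGraph V) {D : ℕ}
    (hD : ∀ v, (G.neighborSet v).encard ≤ D) :
    ∃ c : Sym2 V → Fin (2 * D + 1), ∀ v w w', G.Adj v w → G.Adj v w' → w ≠ w' →
      c s(v, w) ≠ c s(v, w') := by
  let L : SimpleGraph (Sym2 V) := SimpleGraph.fromRel fun e e' =>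
    e ∈ G.edgeSet ∧ e' ∈ G.edgeSet ∧ ∃ v, v ∈ e ∧ v ∈ e'
  have hinc : ∀ v, (G.incidenceSet v).encard ≤ D := by
    intro v
    have : G.incidenceSet v ⊆ (fun w => s(v, w)) '' G.neighborSet v := by
      rintro e ⟨he, hv⟩
      obtain ⟨w, rfl⟩ := hv
      exact ⟨w, he, rfl⟩
    exact (Set.encard_le_encard this).trans ((Set.encard_image_le _ _).trans (hD v))
  obtain ⟨c, hc⟩ := L.exists_greedy_colouring (d := 2 * D) (by
    intro e
    induction e with | _ x y
    have : L.neighborSet s(x, y) ⊆ G.incidenceSet x ∪ G.incidenceSet y := by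
      rintro e ⟨_, h | h⟩
      · obtain ⟨_, he, v, hv, hve⟩ := h
        rcases Sym2.mem_iff.1 hv with rfl | rfl
        · exact Or.inl ⟨he, hve⟩
        · exact Or.inr ⟨he, hve⟩
      · obtain ⟨he, _, v, hve, hv⟩ := h
        rcases Sym2.mem_iff.1 hv with rfl | rfl
        · exact Or.inl ⟨he, hve⟩
        · exact Or.inr ⟨he, hve⟩
    refine (Set.encard_le_encard this).trans ((Set.encard_union_le _ _).trans ?_)
    rw [two_mul, Nat.cast_add]
    exact add_le_add (hinc x) (hinc y))
  refine ⟨c, fun v w w' hw hw' hne => hc _ _ ⟨?_, Or.inl ⟨hw, hw', v, ?_, ?_⟩⟩⟩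
  · intro h
    exact hne (Sym2.congr_right.1 h)
  · exact Sym2.mem_mk_left _ _
  · exact Sym2.mem_mk_left _ _

/-- A proper edge colouring with `2 D + 1` colours turns a graph of maximum degree `D` into a family
of involutions. -/
theorem SimpleGraph.exists_involutions {V : Type*} [Finite V] (G : SimpleGraph V) {D : ℕ}
    (hD : ∀ v, (G.neighborSet v).encard ≤ D) :
    ∃ a : Fin (2 * D + 1) → V → V, (∀ j, Function.Involutive (a j)) ∧
      (∀ v w, G.Adj v w ↔ v ≠ w ∧ ∃ j, a j v = w) ∧
      ∀ j k v, a j v = a k v → a j v ≠ v → j = k := by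
  classical
  obtain ⟨c, hc⟩ := G.exists_edge_colouring hD
  -- `a j` swaps the ends of every edge of colour `j` and fixes all other vertices.
  let a : Fin (2 * D + 1) → V → V := fun j v =>
    if h : ∃ w, G.Adj v w ∧ c s(v, w) = j then h.choose else v
  have h1 : ∀ v w, G.Adj v w → a (c s(v, w)) v = w := by
    intro v w h
    have hex : ∃ w', G.Adj v w' ∧ c s(v, w') = c s(v, w) := ⟨w, h, rfl⟩
    have : a (c s(v, w)) v = hex.choose := dif_pos hex
    rw [this]
    by_contra hne
    exact hc v _ w hex.choose_spec.1 h hne hex.choose_spec.2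
  have h2 : ∀ j v, a j v ≠ v → G.Adj v (a j v) ∧ c s(v, a j v) = j := by
    intro j v h
    by_cases hex : ∃ w, G.Adj v w ∧ c s(v, w) = j
    · have : a j v = hex.choose := dif_pos hex
      rw [this]
      exact hex.choose_spec
    · exact absurd (dif_neg hex) h
  refine ⟨a, fun j v => ?_, fun v w => ⟨fun h => ⟨h.ne, _, h1 v w h⟩, ?_⟩, fun j k v h hne => ?_⟩
  · by_cases h : a j v = v
    · rw [h, h]
    · obtain ⟨hadj, hcol⟩ := h2 j v h
      have := h1 _ _ hadj.symm
      rwa [Sym2.eq_swap, hcol] at this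
  · rintro ⟨hne, j, rfl⟩
    exact (h2 j v hne.symm).1
  · rw [← (h2 j v hne).2, ← (h2 k v (h ▸ hne)).2, h]

end Colouring

/-! ### A common compactification of the finite systems -/

section Compactification

universe u

/-- A common equivariant compactification of a sequence of sets with self-maps `a i j`, on which
any two words act equally on a clopen set of points. -/
structure Compactification {ι : Type} {V : ℕ → Type u} (a : ∀ i, ι → V i → V i) where
  /-- the compact space -/
  K : Type
  [topologicalSpace : TopologicalSpace K]
  [compactSpace : CompactSpace K]
  [t2Space : T2Space K]
  [secondCountable : SecondCountableTopology K]
  [totallyDisconnected : TotallyDisconnectedSpace K]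
  /-- the self-maps of the compact space -/
  s : ι → K → K
  /-- the equivariant maps into the compact space -/
  π : ∀ i, V i → K
  continuous_s : ∀ j, Continuous (s j)
  map_s : ∀ i j v, π i (a i j v) = s j (π i v)
  dense : ∀ C : Set K, IsClosed C → (∀ i v, π i v ∈ C) → ∀ x, x ∈ C
  isOpen_eq : ∀ w w', IsOpen {x | wordAct s w x = wordAct s w' x}
  separates : ∀ i v w w', wordAct s w (π i v) = wordAct s w' (π i v) →
    wordAct (a i) w v = wordAct (a i) w' v

attribute [instance] Compactification.topologicalSpace Compactification.compactSpace
  Compactification.t2Space Compactification.secondCountable Compactification.totallyDisconnected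

/-- The left shift by the letter `j` of a family indexed by words. -/
def wordShift {ι X : Type*} (j : ι) (ω : List ι → X) : List ι → X := fun w => ω (j :: w)

theorem wordAct_wordShift {ι X : Type*} (w : List ι) (ω : List ι → X) :
    wordAct wordShift w ω = fun h => ω (w ++ h) := by
  induction w generalizing ω with
  | nil => rfl
  | cons j w ih => exact ih _

/-- A vertex is coded by the labels of all its images under words, and `K` is the closure of the
codes in a countable product of finite sets. By `hsep`, equality of two words is decided by finitely
many coordinates, hence clopen. -/
theorem exists_compactification {ι : Type} [Countable ι] {L : Type} [Countable L] {V : ℕ → Type u}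
    (a : ∀ i, ι → V i → V i) {m : L → ℕ} (lab : ∀ l i, V i → Fin (m l + 1))
    (hsep : ∀ w w' : List ι, ∃ S : Set L, S.Finite ∧ ∀ i v,
      (∀ l ∈ S, lab l i (wordAct (a i) w v) = lab l i (wordAct (a i) w' v)) →
        wordAct (a i) w v = wordAct (a i) w' v) :
    ∃ C : Compactification a, ∀ l, ∃ f : C.K → Fin (m l + 1), Continuous f ∧
      ∀ i v, f (C.π i v) = lab l i v := by
  let code : ∀ i, V i → List ι → ∀ l, Fin (m l + 1) := fun i v w l => lab l i (wordAct (a i) w v)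
  let K : Set (List ι → ∀ l, Fin (m l + 1)) := closure (⋃ i, Set.range (code i))
  have hshift : ∀ j : ι, Continuous (wordShift j : (List ι → ∀ l, Fin (m l + 1)) → _) := fun j =>
    continuous_pi fun w => continuous_apply (j :: w)
  have hcode : ∀ i j v, code i (a i j v) = wordShift j (code i v) := fun i j v => rfl
  have hK : ∀ i v, code i v ∈ K := fun i v =>
    subset_closure (Set.mem_iUnion.2 ⟨i, Set.mem_range_self v⟩)
  have hmaps : ∀ j, Set.MapsTo (wordShift j) K K := by
    intro j
    refine Set.MapsTo.closure ?_ (hshift j)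
    rintro ω hω
    obtain ⟨i, v, rfl⟩ := Set.mem_iUnion.1 hω
    exact Set.mem_iUnion.2 ⟨i, a i j v, rfl⟩
  let s : ι → K → K := fun j => (hmaps j).restrict
  have hs : ∀ w (x : K), (wordAct s w x).1 = fun h => x.1 (w ++ h) := by
    intro w x
    rw [wordAct_map (f := Subtype.val) (s' := wordShift) (fun j x => rfl), wordAct_wordShift]
  have hdense : ∀ C : Set K, IsClosed C → (∀ i v, (⟨code i v, hK i v⟩ : K) ∈ C) →
      ∀ x, x ∈ C := by
    intro C hC h x
    have h1 : K ⊆ Subtype.val '' C := by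
      refine closure_minimal ?_ (isClosed_closure.isClosedEmbedding_subtypeVal.isClosedMap _ hC)
      intro ω hω
      obtain ⟨i, v, rfl⟩ := Set.mem_iUnion.1 hω
      exact ⟨_, h i v, rfl⟩
    obtain ⟨y, hy, hyx⟩ := h1 x.2
    rwa [← Subtype.ext hyx]
  have hcoord : ∀ w l, Continuous fun x : K => x.1 w l := fun w l =>
    (continuous_apply l).comp ((continuous_apply w).comp continuous_subtype_val)
  have heq : ∀ w w' : List ι, ∀ S : Set L, (∀ i v,
      (∀ l ∈ S, lab l i (wordAct (a i) w v) = lab l i (wordAct (a i) w' v)) →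
        wordAct (a i) w v = wordAct (a i) w' v) → S.Finite →
      ∀ x : K, (∀ l ∈ S, x.1 w l = x.1 w' l) → wordAct s w x = wordAct s w' x := by
    intro w w' S hS hfin x hx
    rw [Subtype.ext_iff, hs, hs]
    funext h l
    -- Since `S` is finite the premise is an open condition, so the implication is closed and need
    -- only be checked on codes.
    have hcl : IsClosed {x : K | (∀ l ∈ S, x.1 w l = x.1 w' l) →
        x.1 (w ++ h) l = x.1 (w' ++ h) l} := by
      have : {x : K | (∀ l ∈ S, x.1 w l = x.1 w' l) → x.1 (w ++ h) l = x.1 (w' ++ h) l} =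
          (⋂ l ∈ S, {x : K | x.1 w l = x.1 w' l})ᶜ ∪
            {x : K | x.1 (w ++ h) l = x.1 (w' ++ h) l} := by
        ext x
        simp [imp_iff_not_or]
      rw [this]
      refine IsClosed.union (IsOpen.isClosed_compl ?_) (isClosed_eq (hcoord _ _) (hcoord _ _))
      refine hfin.isOpen_biInter fun l _ => ?_
      exact (isOpen_discrete {p : Fin (m l + 1) × Fin (m l + 1) | p.1 = p.2}).preimage
        ((hcoord w l).prodMk (hcoord w' l))
    refine hdense _ hcl (fun i v hv => ?_) x hx
    have := hS i v hv
    simp only [code, wordAct_append, this]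
  refine ⟨{
    K := K
    compactSpace := isCompact_iff_compactSpace.1 isClosed_closure.isCompact
    s := s
    π := fun i v => ⟨code i v, hK i v⟩
    continuous_s := fun j => (hshift j).restrict (hmaps j)
    map_s := fun i j v => rfl
    dense := hdense
    isOpen_eq := fun w w' => ?_
    separates := fun i v w w' h => ?_ }, fun l => ⟨fun x => x.1 [] l, hcoord [] l, fun i v => rfl⟩⟩
  · obtain ⟨S, hfin, hS⟩ := hsep w w'
    have : {x | wordAct s w x = wordAct s w' x} = ⋂ l ∈ S, {x : K | x.1 w l = x.1 w' l} := by
      ext x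
      simp only [Set.mem_ofPred_eq, Set.mem_iInter]
      refine ⟨fun h l _ => ?_, heq w w' S hS hfin x⟩
      have := congrFun (congrFun (congrArg Subtype.val h) []) l
      simpa only [hs, List.append_nil] using this
    rw [this]
    refine hfin.isOpen_biInter fun l _ => ?_
    exact (isOpen_discrete {p : Fin (m l + 1) × Fin (m l + 1) | p.1 = p.2}).preimage
      ((hcoord w l).prodMk (hcoord w' l))
  · obtain ⟨S, -, hS⟩ := hsep w w'
    refine hS i v fun l _ => ?_
    have := congrFun (congrFun (congrArg Subtype.val h) []) l
    simpa only [hs, List.append_nil] using this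

variable {ι : Type} {V : ℕ → Type u} {a : ∀ i, ι → V i → V i} (C : Compactification a)

namespace Compactification

theorem isClosed_eq (w w' : List ι) : IsClosed {x | wordAct C.s w x = wordAct C.s w' x} := by
  have : ∀ w, Continuous (wordAct C.s w) := by
    intro w
    induction w with
    | nil => exact continuous_id
    | cons j w ih => exact ih.comp (C.continuous_s j)
  exact _root_.isClosed_eq (this w) (this w')

theorem isClopen_eq (w w' : List ι) : IsClopen {x | wordAct C.s w x = wordAct C.s w' x} :=
  ⟨C.isClosed_eq w w', C.isOpen_eq w w'⟩

theorem isClopen_eq_single (j k : ι) : IsClopen {x | C.s j x = C.s k x} :=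
  C.isClopen_eq [j] [k]

theorem isClopen_eq_self (j : ι) : IsClopen {x | C.s j x = x} :=
  C.isClopen_eq [j] []

theorem wordAct_π (i : ℕ) (w : List ι) (v : V i) :
    C.π i (wordAct (a i) w v) = wordAct C.s w (C.π i v) :=
  wordAct_map (C.map_s i) w v

theorem wordAct_eq_iff (i : ℕ) (v : V i) (w w' : List ι) :
    wordAct C.s w (C.π i v) = wordAct C.s w' (C.π i v) ↔
      wordAct (a i) w v = wordAct (a i) w' v :=
  ⟨C.separates i v w w', fun h => by rw [← wordAct_π, ← wordAct_π, h]⟩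

theorem involutive_s (h : ∀ i j, Function.Involutive (a i j)) (j : ι) :
    Function.Involutive (C.s j) :=
  C.dense {x | wordAct C.s [j, j] x = wordAct C.s [] x} (C.isClosed_eq _ _) fun i v =>
    (C.wordAct_eq_iff i v _ _).2 (h i j v)

theorem s_eq_iff (i : ℕ) (v : V i) (j k : ι) :
    C.s j (C.π i v) = C.s k (C.π i v) ↔ a i j v = a i k v :=
  C.wordAct_eq_iff i v [j] [k]

theorem s_eq_self_iff (i : ℕ) (v : V i) (j : ι) :
    C.s j (C.π i v) = C.π i v ↔ a i j v = v :=
  C.wordAct_eq_iff i v [j] []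

/-- Equalities of words are clopen conditions, so this implication is closed and passes from the
dense images to all of `K`. -/
theorem eq_of_s_eq (h : ∀ i j k v, a i j v = a i k v → a i j v ≠ v → j = k) {j k : ι} {x : C.K}
    (hx : C.s j x = C.s k x) (hne : C.s j x ≠ x) : j = k := by
  revert hx hne
  refine C.dense {x | C.s j x = C.s k x → C.s j x ≠ x → j = k} ?_ ?_ x
  · have : {x | C.s j x = C.s k x → C.s j x ≠ x → j = k} =
        {x | C.s j x = C.s k x}ᶜ ∪ ({x | C.s j x = x} ∪ {_x | j = k}) := by
      ext x
      simp only [Set.mem_ofPred_eq, Set.mem_union, Set.mem_compl_iff]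
      tauto
    rw [this]
    exact (C.isClopen_eq_single j k).compl.1.union
      ((C.isClopen_eq_self j).1.union isClosed_const)
  · intro i v hv hne
    exact h i j k v ((C.s_eq_iff i v j k).1 hv) fun h' => hne ((C.s_eq_self_iff i v j).2 h')

theorem exists_π_mem {S : Set C.K} (hS : IsOpen S) {x : C.K} (hx : x ∈ S) :
    ∃ i v, C.π i v ∈ S := by
  by_contra! h
  exact C.dense Sᶜ hS.isClosed_compl h x hx

instance : MeasurableSpace C.K := borel _

instance : BorelSpace C.K := ⟨rfl⟩

instance : PolishSpace C.K := by
  let := TopologicalSpace.metrizableSpaceMetric C.K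
  infer_instance

/-- The set of generators moving a point is locally constant, so every point shares it with the
image of some vertex. -/
theorem encard_active_le [Finite ι] {D : ℕ}
    (h : ∀ i v, {j | a i j v ≠ v}.encard ≤ D) (x : C.K) : {j | C.s j x ≠ x}.encard ≤ D := by
  have hopen : IsOpen (⋂ j, {y | C.s j y = y ↔ C.s j x = x}) := by
    refine isOpen_iInter_of_finite fun j => ?_
    by_cases hj : C.s j x = x
    · simpa only [hj, iff_true] using (C.isClopen_eq_self j).2
    · simp only [hj, iff_false]
      exact (C.isClopen_eq_self j).compl.2
  obtain ⟨i, v, hv⟩ := C.exists_π_mem hopen (x := x) (Set.mem_iInter.2 fun j => Iff.rfl)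
  refine le_of_eq_of_le ?_ (h i v)
  congr 1
  ext j
  exact not_congr ((Set.mem_iInter.1 hv j).symm.trans (C.s_eq_self_iff i v j))

end Compactification

end Compactification

/-! ### Cluster rank: measurability, approximation by balls, continuity -/

section ClusterRank

variable {ι Ω : Type*} [MeasurableSpace Ω]

/-- The integral of `1 - 1 / |cluster|`. -/
noncomputable def clusterRank (s : ι → Ω → Ω) (O : ι → Set Ω) (μ : Measure Ω) : ℝ :=
  ∫ x, (1 - ((cluster s O x).ncard : ℝ)⁻¹) ∂μ

/-- The integral of `1 - 1 / |clusterBall|`. -/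
noncomputable def ballRank (s : ι → Ω → Ω) (O : ι → Set Ω) (r : ℕ) (μ : Measure Ω) : ℝ :=
  ∫ x, (1 - ((clusterBall s O r x).ncard : ℝ)⁻¹) ∂μ

variable {s : ι → Ω → Ω} {O : ι → Set Ω} {μ : Measure Ω}

theorem measurable_wordAct (hs : ∀ j, Measurable (s j)) (w : List ι) :
    Measurable (wordAct s w) := by
  induction w with
  | nil => exact measurable_id
  | cons j w ih => exact ih.comp (hs j)

theorem measurableSet_openWord (hs : ∀ j, Measurable (s j)) (hO : ∀ j, MeasurableSet (O j))
    (w : List ι) : MeasurableSet {x | OpenWord s O w x} := by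
  induction w with
  | nil => exact MeasurableSet.univ
  | cons j w ih => exact (hO j).inter (hs j ih)

variable [Finite ι]

/-- The ball size factors through `p`, which records in a finite type which short words are allowed
and which coincide. -/
theorem measurable_ncard_clusterBall [MeasurableEq Ω] (hs : ∀ j, Measurable (s j))
    (hO : ∀ j, MeasurableSet (O j)) (r : ℕ) :
    Measurable fun x => (clusterBall s O r x).ncard := by
  have : Finite {w : List ι // w.length ≤ r} := List.finite_length_le ι r
  let W := {w : List ι // w.length ≤ r}
  let p : Ω → (W → Prop) × (W → W → Prop) := fun x =>
    (fun w => OpenWord s O w.1 x, fun w w' => wordAct s w.1 x = wordAct s w'.1 x)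
  have hp : Measurable p := by
    refine Measurable.prodMk (measurable_pi_lambda _ fun w => ?_)
      (measurable_pi_lambda _ fun w => measurable_pi_lambda _ fun w' => ?_)
    · exact measurableSet_setOfPred.1 (measurableSet_openWord hs hO w.1)
    · exact measurableSet_setOfPred.1 (measurableSet_eq_fun (measurable_wordAct hs w.1)
        (measurable_wordAct hs w'.1))
  intro T _
  have : (fun x => (clusterBall s O r x).ncard) ⁻¹' T =
      p ⁻¹' (p '' ((fun x => (clusterBall s O r x).ncard) ⁻¹' T)) := by
    refine (Set.subset_preimage_image _ _).antisymm ?_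
    rintro x ⟨y, hy, hyx⟩
    have h1 := congrArg Prod.fst hyx
    have h2 := congrArg Prod.snd hyx
    have : (clusterBall s O r y).ncard = (clusterBall s O r x).ncard :=
      ncard_clusterBall_congr (fun w hw => iff_of_eq (congrFun h1 ⟨w, hw⟩))
        fun w w' hw hw' => iff_of_eq (congrFun (congrFun h2 ⟨w, hw⟩) ⟨w', hw'⟩)
    rwa [Set.mem_preimage, ← this]
  rw [this]
  exact hp (Set.toFinite _).measurableSet

theorem abs_one_sub_inv_natCast_le (n : ℕ) : |1 - (n : ℝ)⁻¹| ≤ 1 := by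
  have h1 : (0 : ℝ) ≤ (n : ℝ)⁻¹ := by positivity
  have h2 : (n : ℝ)⁻¹ ≤ 1 := Nat.cast_inv_le_one n
  rw [abs_le]
  constructor <;> linarith

theorem integrable_one_sub_inv [IsFiniteMeasure μ] {f : Ω → ℕ}
    (hf : Measurable fun x => (f x : ℝ)⁻¹) : Integrable (fun x => 1 - (f x : ℝ)⁻¹) μ :=
  Integrable.of_bound (measurable_const.sub hf).aestronglyMeasurable 1
    (ae_of_all _ fun x => abs_one_sub_inv_natCast_le (f x))

variable [MeasurableEq Ω]

theorem integrable_ball [IsFiniteMeasure μ] (hs : ∀ j, Measurable (s j))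
    (hO : ∀ j, MeasurableSet (O j)) (r : ℕ) :
    Integrable (fun x => 1 - ((clusterBall s O r x).ncard : ℝ)⁻¹) μ :=
  integrable_one_sub_inv
    ((measurable_from_top (f := fun n : ℕ => (n : ℝ)⁻¹)).comp
      (measurable_ncard_clusterBall hs hO r))

theorem integrable_cluster [IsFiniteMeasure μ] (hs : ∀ j, Measurable (s j))
    (hO : ∀ j, MeasurableSet (O j)) :
    Integrable (fun x => 1 - ((cluster s O x).ncard : ℝ)⁻¹) μ := by
  refine integrable_one_sub_inv ?_
  refine measurable_of_tendsto_metrizable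
    (f := fun r x => ((clusterBall s O r x).ncard : ℝ)⁻¹) (fun r => ?_) ?_
  · exact (measurable_from_top (f := fun n : ℕ => (n : ℝ)⁻¹)).comp
      (measurable_ncard_clusterBall hs hO r)
  · rw [tendsto_pi_nhds]
    intro x
    rw [tendsto_iff_dist_tendsto_zero]
    refine squeeze_zero (fun _ => dist_nonneg) (fun r => abs_inv_ncard_clusterBall_sub_le r x) ?_
    simpa using tendsto_one_div_add_atTop_nhds_zero_nat (𝕜 := ℝ)

theorem abs_clusterRank_sub_ballRank_le [IsProbabilityMeasure μ] (hs : ∀ j, Measurable (s j))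
    (hO : ∀ j, MeasurableSet (O j)) (r : ℕ) :
    |clusterRank s O μ - ballRank s O r μ| ≤ ((r : ℝ) + 1)⁻¹ := by
  have h : ∀ x, ‖(1 - ((cluster s O x).ncard : ℝ)⁻¹) - (1 - ((clusterBall s O r x).ncard : ℝ)⁻¹)‖ ≤
      ((r : ℝ) + 1)⁻¹ := by
    intro x
    rw [Real.norm_eq_abs, sub_sub_sub_cancel_left]
    exact abs_inv_ncard_clusterBall_sub_le r x
  rw [clusterRank, ballRank, ← integral_sub (integrable_cluster hs hO) (integrable_ball hs hO r)]
  simpa using norm_integral_le_of_norm_le_const (ae_of_all μ h)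

/-- The cluster rank is continuous in the set of allowed steps, with respect to the measure of the
symmetric difference. -/
theorem exists_abs_clusterRank_sub_lt [IsProbabilityMeasure μ]
    (hs : ∀ j, MeasurePreserving (s j) μ μ) {ε : ℝ} (hε : 0 < ε) :
    ∃ δ > 0, ∀ O O' : ι → Set Ω, (∀ j, MeasurableSet (O j)) → (∀ j, MeasurableSet (O' j)) →
      ∀ B : Set Ω, MeasurableSet B → (∀ x ∉ B, ∀ j, x ∈ O j ↔ x ∈ O' j) → μ.real B < δ →
        |clusterRank s O μ - clusterRank s O' μ| < ε := by
  have hsm := fun j => (hs j).measurable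
  obtain ⟨r, hr⟩ := exists_nat_one_div_lt (show 0 < ε / 3 by positivity)
  rw [one_div] at hr
  have hfin : {w : List ι | w.length ≤ r}.Finite := List.finite_length_le ι r
  -- A third of `ε` is for the two ball ranks, which differ by at most the number of short words
  -- times `μ.real B`; the other two thirds pay for passing from clusters to balls.
  refine ⟨ε / (3 * (hfin.toFinset.card + 1)), by positivity, ?_⟩
  intro O O' hO hO' B hB hOO' hδ
  have hact : ∀ w, MeasurePreserving (wordAct s w) μ μ := by
    intro w
    induction w with
    | nil => exact MeasurePreserving.id μ
    | cons j w ih => exact ih.comp (hs j)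
  have hball : |ballRank s O r μ - ballRank s O' r μ| ≤ ε / 3 := by
    -- Outside `S` no short word meets `B`, so the balls for `O` and `O'` have equal size.
    let S : Set Ω := ⋃ w ∈ hfin.toFinset, wordAct s w ⁻¹' B
    have hS : MeasurableSet S := Finset.measurableSet_biUnion _ fun w _ => (hact w).measurable hB
    have hSle : μ.real S ≤ hfin.toFinset.card * μ.real B := by
      refine (measureReal_biUnion_finset_le _ _).trans ?_
      rw [← nsmul_eq_mul]
      refine Finset.sum_le_card_nsmul _ _ _ fun w _ => ?_
      rw [(hact w).measureReal_preimage hB.nullMeasurableSet]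
    rw [ballRank, ballRank, ← integral_sub (integrable_ball hsm hO r) (integrable_ball hsm hO' r)]
    have hle : ‖∫ x, ((1 - ((clusterBall s O r x).ncard : ℝ)⁻¹) -
        (1 - ((clusterBall s O' r x).ncard : ℝ)⁻¹)) ∂μ‖ ≤ ∫ x, S.indicator 1 x ∂μ := by
      refine norm_integral_le_of_norm_le
        ((integrable_indicator_iff hS).2 (integrable_const 1).integrableOn) ?_
      refine ae_of_all _ fun x => ?_
      by_cases hx : x ∈ S
      · rw [Set.indicator_of_mem hx, sub_sub_sub_cancel_left, Real.norm_eq_abs, Pi.one_apply,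
          abs_sub_le_iff]
        have h1 : ∀ n : ℕ, (0 : ℝ) ≤ (n : ℝ)⁻¹ := fun n => by positivity
        have h2 : ∀ n : ℕ, (n : ℝ)⁻¹ ≤ 1 := fun n => Nat.cast_inv_le_one n
        constructor
        · exact (sub_le_self _ (h1 _)).trans (h2 _)
        · exact (sub_le_self _ (h1 _)).trans (h2 _)
      · rw [Set.indicator_of_notMem hx]
        have : (clusterBall s O r x).ncard = (clusterBall s O' r x).ncard := by
          refine ncard_clusterBall_congr (openWord_congr fun w hw => hOO' _ fun hB => hx ?_)
            fun w w' _ _ => Iff.rfl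
          exact Set.mem_biUnion (hfin.mem_toFinset.2 hw) hB
        rw [this, sub_self, norm_zero]
    refine hle.trans ?_
    rw [integral_indicator_one hS]
    refine hSle.trans ?_
    have h0 : (0 : ℝ) ≤ hfin.toFinset.card := by positivity
    calc (hfin.toFinset.card : ℝ) * μ.real B
        ≤ (hfin.toFinset.card + 1) * (ε / (3 * (hfin.toFinset.card + 1))) := by
          gcongr
          linarith
      _ = ε / 3 := by field_simp
  have h1 := abs_clusterRank_sub_ballRank_le (μ := μ) hsm hO r
  have h2 := abs_clusterRank_sub_ballRank_le (μ := μ) hsm hO' r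
  rw [abs_le] at h1 h2 hball
  rw [abs_lt]
  constructor <;> linarith [h1.1, h1.2, h2.1, h2.2, hball.1, hball.2]

end ClusterRank

/-! ### Graphings generated by involutions; edge colourings as step colourings -/

section Generated

universe u

/-- The steps `x ↦ s j x` that move `x` and whose colour lies in `A`. -/
def colouredSteps {ι Ω X : Type*} (s : ι → Ω → Ω) (c : Ω → ι → X) (A : Set X) (j : ι) : Set Ω :=
  {x | s j x ≠ x ∧ c x j ∈ A}

theorem measurableSet_colouredSteps {ι Ω X : Type*} [MeasurableSpace Ω] [MeasurableEq Ω]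
    [MeasurableSpace X] [DiscreteMeasurableSpace X] {s : ι → Ω → Ω} {c : Ω → ι → X}
    (hs : ∀ j, Measurable (s j)) (hc : ∀ j, Measurable fun x => c x j) (A : Set X) (j : ι) :
    MeasurableSet (colouredSteps s c A j) :=
  (measurableSet_eq_fun (hs j) measurable_id).compl.inter (hc j (MeasurableSet.of_discrete (s := A)))

/-- The edges of the graphing are the pairs `{x, s j x}` for a family of measure preserving
involutions `s j`, and each edge arises from only one `j`. -/
structure Graphing.IsGeneratedBy (G : Graphing.{u}) {ι : Type} (s : ι → G.Ω → G.Ω) : Prop where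
  measurePreserving : ∀ j, MeasurePreserving (s j) G.μ G.μ
  involutive : ∀ j, Function.Involutive (s j)
  eq_of_eq : ∀ j k x, s j x = s k x → s j x ≠ x → j = k
  adj_iff : ∀ x y, G.graph.Adj x y ↔ x ≠ y ∧ ∃ j, s j x = y

namespace Graphing.IsGeneratedBy

variable {G : Graphing.{u}} {ι : Type} {s : ι → G.Ω → G.Ω} (hG : G.IsGeneratedBy s)

include hG

theorem measurable (j : ι) : Measurable (s j) :=
  (hG.measurePreserving j).measurable

theorem adj (j : ι) {x : G.Ω} (h : s j x ≠ x) : G.graph.Adj x (s j x) :=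
  (hG.adj_iff _ _).2 ⟨h.symm, j, rfl⟩

theorem component_eq_cluster (F : Set G.Edge) (x : G.Ω) :
    G.component F x = cluster s (fun j => {y | s(y, s j y) ∈ Subtype.val '' F}) x := by
  ext y
  constructor
  · intro h
    replace h := (SimpleGraph.reachable_iff_reflTransGen _ _).1 h
    induction h with
    | refl => exact ⟨[], trivial, rfl⟩
    | @tail y z _ hyz ih =>
      obtain ⟨w, ho, rfl⟩ := ih
      rw [SimpleGraph.fromEdgeSet_adj] at hyz
      obtain ⟨e, -, he⟩ := hyz.1
      have hadj : s(wordAct s w x, z) ∈ G.graph.edgeSet := he ▸ e.2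
      obtain ⟨-, j, rfl⟩ := (hG.adj_iff (wordAct s w x) z).1 hadj
      refine ⟨w ++ [j], (openWord_append _ _ _).2 ⟨ho, hyz.1, trivial⟩, wordAct_append _ _ _⟩
  · intro h
    refine cluster_subset_of_closed (S := G.component F x) SimpleGraph.Reachable.rfl ?_ h
    intro y hy j hj
    refine hy.trans (SimpleGraph.Adj.reachable ?_)
    rw [SimpleGraph.fromEdgeSet_adj]
    refine ⟨hj, fun h => ?_⟩
    obtain ⟨e, -, he⟩ := hj
    have hadj : s(y, s j y) ∈ G.graph.edgeSet := he ▸ e.2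
    exact hadj.ne h

theorem rank_eq (F : Set G.Edge) :
    G.rank F = clusterRank s (fun j => {y | s(y, s j y) ∈ Subtype.val '' F}) G.μ := by
  simp only [Graphing.rank, clusterRank, hG.component_eq_cluster]

theorem exists_edge_rep (e : G.Edge) : ∃ x j, s j x ≠ x ∧ e.1 = s(x, s j x) := by
  obtain ⟨e, he⟩ := e
  induction e with | _ x y
  obtain ⟨hne, j, rfl⟩ := (hG.adj_iff x y).1 he
  exact ⟨x, j, hne.symm, rfl⟩

/-- An edge determines its generator and has just two starting points; for the reversed orientation,
uniqueness is applied at `s j x`. -/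
theorem eq_or_eq_of_edge_eq {x y : G.Ω} {j k : ι} (hx : s j x ≠ x)
    (h : s(x, s j x) = s(y, s k y)) : j = k ∧ (y = x ∨ y = s j x) := by
  rcases Sym2.eq_iff.1 h with ⟨rfl, h⟩ | ⟨h1, h2⟩
  · exact ⟨hG.eq_of_eq _ _ _ h hx, Or.inl rfl⟩
  · subst h2
    refine ⟨hG.eq_of_eq j k (s j x) (by rw [hG.involutive j x]; exact h1) ?_, Or.inr rfl⟩
    rw [hG.involutive j x]
    exact hx.symm

/-- A symmetric colouring of the steps is a colouring of the edges. -/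
theorem exists_edge_colouring {X : Type*} {c : G.Ω → ι → X}
    (hc : ∀ x j, s j x ≠ x → c (s j x) j = c x j) :
    ∃ P : G.Edge → X, ∀ (e : G.Edge) x j, s j x ≠ x → e.1 = s(x, s j x) → P e = c x j := by
  choose y k hne he using hG.exists_edge_rep
  refine ⟨fun e => c (y e) (k e), fun e x j hx hex => ?_⟩
  obtain ⟨hjk, h | h⟩ := hG.eq_or_eq_of_edge_eq hx (hex.symm.trans (he e))
  · simp only [h, hjk]
  · simp only [h, ← hjk, hc x j hx]

/-- A union of colour classes pulls back to ordered pairs as a countable union of graphs of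
restricted generators and their transposes, a symmetric Borel set. -/
theorem measurable_edge_colouring [Countable ι] {X : Type*} [MeasurableSpace X]
    [DiscreteMeasurableSpace X] {c : G.Ω → ι → X} {P : G.Edge → X}
    (hc : ∀ j, Measurable fun x => c x j)
    (hP : ∀ (e : G.Edge) x j, s j x ≠ x → e.1 = s(x, s j x) → P e = c x j) : Measurable P := by
  intro T _
  let S : ι → Set (G.Ω × G.Ω) := fun j => {p | p.1 ∈ colouredSteps s c T j ∧ p.2 = s j p.1}
  refine ⟨{e | ∃ x j, x ∈ colouredSteps s c T j ∧ e = s(x, s j x)}, ?_, ?_⟩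
  · have h : (fun p : G.Ω × G.Ω => s(p.1, p.2)) ⁻¹'
        {e | ∃ x j, x ∈ colouredSteps s c T j ∧ e = s(x, s j x)} =
        ⋃ j, (S j ∪ Prod.swap ⁻¹' S j) := by
      ext ⟨x, y⟩
      simp only [Set.mem_preimage, Set.mem_ofPred_eq, Set.mem_iUnion, Set.mem_union, S]
      constructor
      · rintro ⟨z, j, hz, h⟩
        rcases Sym2.eq_iff.1 h with ⟨rfl, h⟩ | ⟨h, rfl⟩
        · exact ⟨j, Or.inl ⟨hz, h⟩⟩
        · exact ⟨j, Or.inr ⟨hz, h⟩⟩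
      · rintro ⟨j, ⟨hz, h⟩ | ⟨hz, h⟩⟩
        · exact ⟨x, j, hz, by rw [h]⟩
        · exact ⟨y, j, hz, by rw [Sym2.eq_swap]; exact congrArg (fun z => s(y, z)) h⟩
    change MeasurableSet ((fun p : G.Ω × G.Ω => s(p.1, p.2)) ⁻¹' _)
    rw [h]
    have hS : ∀ j, MeasurableSet (S j) := fun j =>
      (measurable_fst (measurableSet_colouredSteps hG.measurable hc T j)).inter
        (measurableSet_eq_fun measurable_snd ((hG.measurable j).comp measurable_fst))
    exact MeasurableSet.iUnion fun j => (hS j).union (measurable_swap (hS j))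
  · ext e
    simp only [Set.mem_preimage, Set.mem_ofPred_eq]
    constructor
    · rintro ⟨x, j, hx, h⟩
      rw [hP e x j hx.1 h]
      exact hx.2
    · intro he
      obtain ⟨x, j, hx, h⟩ := hG.exists_edge_rep e
      exact ⟨x, j, ⟨hx, by rwa [← hP e x j hx h]⟩, h⟩

theorem measurable_step_colour {X : Type*} [MeasurableSpace X] {P : G.Edge → X}
    (hP : Measurable P) (x₀ : X) (j : ι) {q : G.Ω → X}
    (hq : ∀ x (h : s j x ≠ x), q x = P ⟨s(x, s j x), hG.adj j h⟩)
    (hq' : ∀ x, s j x = x → q x = x₀) : Measurable q := by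
  have hfix : MeasurableSet {x | s j x = x} := measurableSet_eq_fun (hG.measurable j) measurable_id
  intro T hT
  obtain ⟨T', hT', hTT'⟩ := hP hT
  have h1 : MeasurableSet {x | s(x, s j x) ∈ T'} :=
    (measurable_id.prodMk (hG.measurable j)) hT'
  have : q ⁻¹' T = ({x | s j x = x}ᶜ ∩ {x | s(x, s j x) ∈ T'}) ∪
      ({x | s j x = x} ∩ {_x | x₀ ∈ T}) := by
    ext x
    by_cases h : s j x = x
    · simp [h, hq' x h]
    · have h2 := Set.ext_iff.1 hTT' ⟨s(x, s j x), hG.adj j h⟩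
      simp only [Set.mem_preimage] at h2
      simp [h, hq x h, h2]
  rw [this]
  exact (hfix.compl.inter h1).union (hfix.inter (MeasurableSet.const _))

/-- Quotients of the rank function in terms of colourings of the steps. -/
theorem mem_quotientSet_iff [Countable ι] {k : ℕ}
    {v : EuclideanSpace ℝ (Finset (Fin (k + 1)))} :
    v ∈ quotientSet (k + 1) G.rank ↔ ∃ c : G.Ω → ι → Fin (k + 1),
      (∀ j, Measurable fun x => c x j) ∧ (∀ x j, s j x ≠ x → c (s j x) j = c x j) ∧
      ∀ A : Finset (Fin (k + 1)),
        v A = clusterRank s (colouredSteps s c (A : Set (Fin (k + 1)))) G.μ := by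
  classical
  have key : ∀ (P : G.Edge → Fin (k + 1)) (c : G.Ω → ι → Fin (k + 1)) (A : Set (Fin (k + 1))),
      (∀ (e : G.Edge) x j, s j x ≠ x → e.1 = s(x, s j x) → P e = c x j) →
      G.rank (P ⁻¹' A) = clusterRank s (colouredSteps s c A) G.μ := by
    intro P c A hP
    rw [hG.rank_eq]
    congr 1
    ext j x
    simp only [Set.mem_ofPred_eq, colouredSteps]
    constructor
    · rintro ⟨e, he, hex⟩
      have hadj : s(x, s j x) ∈ G.graph.edgeSet := hex ▸ e.2
      have hne : s j x ≠ x := hadj.ne'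
      exact ⟨hne, by rw [← hP e x j hne hex]; exact he⟩
    · rintro ⟨hne, hA⟩
      refine ⟨⟨s(x, s j x), hG.adj j hne⟩, ?_, rfl⟩
      rw [Set.mem_preimage, hP _ x j hne rfl]
      exact hA
  constructor
  · rintro ⟨P, hP, hv⟩
    -- The default colour `0` at fixed points is harmless: `colouredSteps` ignores steps that do not
    -- move.
    let c : G.Ω → ι → Fin (k + 1) := fun x j =>
      if h : s j x ≠ x then P ⟨s(x, s j x), hG.adj j h⟩ else 0
    have hc : ∀ x j (h : s j x ≠ x), c x j = P ⟨s(x, s j x), hG.adj j h⟩ := fun x j h => dif_pos h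
    refine ⟨c, fun j => ?_, fun x j h => ?_, fun A => ?_⟩
    · exact hG.measurable_step_colour hP 0 j (fun x h => hc x j h)
        fun x h => dif_neg (not_not.2 h)
    · have h' : s j (s j x) ≠ s j x := by
        rw [hG.involutive j x]
        exact h.symm
      rw [hc _ _ h, hc _ _ h']
      congr 2
      rw [hG.involutive j x]
      exact Sym2.eq_swap
    · rw [hv A]
      refine key P c A fun e x j h he => ?_
      rw [hc x j h]
      exact congrArg P (Subtype.ext he)
  · rintro ⟨c, hcm, hc, hv⟩
    obtain ⟨P, hP⟩ := hG.exists_edge_colouring hc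
    exact ⟨P, hG.measurable_edge_colouring hcm hP, fun A => (hv A).trans (key P c A hP).symm⟩

end Graphing.IsGeneratedBy

end Generated

/-! ### Finite graphs and involution systems as graphings -/

section Construction

universe u

theorem SimpleGraph.toGraphing_isGeneratedBy {V : Type u} [Fintype V] [Nonempty V]
    (G : SimpleGraph V) {ι : Type} {a : ι → V → V} (hinv : ∀ j, Function.Involutive (a j))
    (huniq : ∀ j k v, a j v = a k v → a j v ≠ v → j = k)
    (hadj : ∀ v w, G.Adj v w ↔ v ≠ w ∧ ∃ j, a j v = w) :
    G.toGraphing.IsGeneratedBy a where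
  measurePreserving j := by
    let : MeasurableSpace V := ⊤
    have : DiscreteMeasurableSpace V := ⟨fun _ => trivial⟩
    change MeasurePreserving (a j) ((Fintype.card V : ℝ≥0∞)⁻¹ • (Measure.count : Measure V))
      ((Fintype.card V : ℝ≥0∞)⁻¹ • (Measure.count : Measure V))
    refine ⟨measurable_from_top, ?_⟩
    ext S hS
    rw [Measure.map_apply measurable_from_top hS, Measure.smul_apply, Measure.smul_apply,
      Measure.count_apply (measurable_from_top hS), Measure.count_apply hS,
      (Set.encard_preimage_of_bijective (hinv j).bijective S)]
  involutive := hinv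
  eq_of_eq := huniq
  adj_iff := hadj

/-- The graph whose edges are the pairs `{x, s j x}`. -/
def involutionGraph {ι Ω : Type*} (s : ι → Ω → Ω) (hs : ∀ j, Function.Involutive (s j)) :
    SimpleGraph Ω where
  Adj x y := x ≠ y ∧ ∃ j, s j x = y
  symm := ⟨by
    rintro x _ ⟨hne, j, rfl⟩
    exact ⟨hne.symm, j, hs j x⟩⟩
  loopless := ⟨fun _ h => h.1 rfl⟩

section

variable {ι Ω : Type*} {s : ι → Ω → Ω} (hs : ∀ j, Function.Involutive (s j))

theorem neighborSet_involutionGraph (x : Ω) :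
    (involutionGraph s hs).neighborSet x = (fun j => s j x) '' {j | s j x ≠ x} := by
  ext y
  constructor
  · rintro ⟨hne, j, rfl⟩
    exact ⟨j, hne.symm, rfl⟩
  · rintro ⟨j, hne, rfl⟩
    exact ⟨Ne.symm hne, j, rfl⟩

theorem encard_neighborSet_involutionGraph_le {D : ℕ} {x : Ω}
    (h : {j | s j x ≠ x}.encard ≤ D) : ((involutionGraph s hs).neighborSet x).encard ≤ D := by
  rw [neighborSet_involutionGraph]
  exact (Set.encard_image_le _ _).trans h

/-- By `huniq` distinct moving generators reach distinct neighbours, so counting neighbours is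
counting generators. -/
theorem encard_neighborSet_inter [Fintype ι]
    (huniq : ∀ j k x, s j x = s k x → s j x ≠ x → j = k) (B : Set Ω) (x : Ω) :
    ((((involutionGraph s hs).neighborSet x ∩ B).encard : ENat) : ℝ≥0∞) =
      ∑ j, ({y | s j y ≠ y} ∩ s j ⁻¹' B).indicator 1 x := by
  classical
  have h : (involutionGraph s hs).neighborSet x ∩ B = (fun j => s j x) ''
      ((Finset.univ.filter fun j => s j x ≠ x ∧ s j x ∈ B : Finset ι) : Set ι) := by
    rw [neighborSet_involutionGraph]
    ext y
    simp only [Set.mem_inter_iff, Set.mem_image, Finset.coe_filter, Finset.mem_univ, true_and,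
      Set.mem_ofPred_eq]
    constructor
    · rintro ⟨⟨j, hj, rfl⟩, hB⟩
      exact ⟨j, ⟨hj, hB⟩, rfl⟩
    · rintro ⟨j, ⟨hj, hB⟩, rfl⟩
      exact ⟨⟨j, hj, rfl⟩, hB⟩
  rw [h, Set.InjOn.encard_image, Set.encard_coe_eq_coe_finsetCard, Finset.card_filter]
  · simp [Set.indicator_apply]
  · intro j hj k _ hjk
    simp only [Finset.coe_filter, Finset.mem_univ, true_and, Set.mem_ofPred_eq] at hj
    exact huniq j k x hjk hj.1

/-- For each `j`, the involution `s j` exchanges the moved points of `A` sent into `B` with the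
moved points of `B` sent into `A`, and preserves `μ`. -/
theorem setLIntegral_encard_neighborSet_inter [Fintype ι] [MeasurableSpace Ω] [MeasurableEq Ω]
    {μ : Measure Ω} (hμ : ∀ j, MeasurePreserving (s j) μ μ)
    (huniq : ∀ j k x, s j x = s k x → s j x ≠ x → j = k) {A B : Set Ω} (hA : MeasurableSet A)
    (hB : MeasurableSet B) :
    ∫⁻ x in A, (((involutionGraph s hs).neighborSet x ∩ B).encard : ℝ≥0∞) ∂μ =
      ∫⁻ x in B, (((involutionGraph s hs).neighborSet x ∩ A).encard : ℝ≥0∞) ∂μ := by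
  have hmove : ∀ j, MeasurableSet {y | s j y ≠ y} := fun j =>
    (measurableSet_eq_fun (hμ j).measurable measurable_id).compl
  have key : ∀ A B : Set Ω, MeasurableSet A → MeasurableSet B →
      ∫⁻ x in A, (((involutionGraph s hs).neighborSet x ∩ B).encard : ℝ≥0∞) ∂μ =
        ∑ j, μ ({y | s j y ≠ y} ∩ s j ⁻¹' B ∩ A) := by
    intro A B hA hB
    have hm : ∀ j, MeasurableSet ({y | s j y ≠ y} ∩ s j ⁻¹' B) := fun j =>
      (hmove j).inter ((hμ j).measurable hB)
    simp only [encard_neighborSet_inter hs huniq]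
    rw [lintegral_finsetSum _ fun j _ => measurable_one.indicator (hm j)]
    refine Finset.sum_congr rfl fun j _ => ?_
    rw [lintegral_indicator_one (hm j), Measure.restrict_apply (hm j)]
  rw [key A B hA hB, key B A hB hA]
  refine Finset.sum_congr rfl fun j _ => ?_
  rw [← (hμ j).measure_preimage
    (((hmove j).inter ((hμ j).measurable hB)).inter hA).nullMeasurableSet]
  congr 1
  ext x
  simp only [Set.mem_preimage, Set.mem_inter_iff, Set.mem_ofPred_eq, hs j x, ne_comm (a := x)]
  tauto

end

/-- The graphing generated by finitely many measure preserving involutions. -/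
def Graphing.ofInvolutions {ι : Type} [Fintype ι] {Ω : Type u} [MeasurableSpace Ω]
    [StandardBorelSpace Ω] {s : ι → Ω → Ω} (hs : ∀ j, Function.Involutive (s j)) (μ : Measure Ω)
    [IsProbabilityMeasure μ] (hμ : ∀ j, MeasurePreserving (s j) μ μ)
    (huniq : ∀ j k x, s j x = s k x → s j x ≠ x → j = k) {D : ℕ}
    (hD : ∀ x, {j | s j x ≠ x}.encard ≤ D) : Graphing.{u} where
  Ω := Ω
  graph := involutionGraph s hs
  measurableSet_adj := by
    have : {p : Ω × Ω | (involutionGraph s hs).Adj p.1 p.2} =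
        {p | p.1 = p.2}ᶜ ∩ ⋃ j, {p | s j p.1 = p.2} := by
      ext p
      simp [involutionGraph]
    rw [this]
    exact (measurableSet_eq_fun measurable_fst measurable_snd).compl.inter
      (MeasurableSet.iUnion fun j =>
        measurableSet_eq_fun ((hμ j).measurable.comp measurable_fst) measurable_snd)
  bounded_degree := ⟨D, fun x => encard_neighborSet_involutionGraph_le hs (hD x)⟩
  μ := μ
  involution_invariant _ _ hA hB := setLIntegral_encard_neighborSet_inter hs hμ huniq hA hB

theorem Graphing.isGeneratedBy_ofInvolutions {ι : Type} [Fintype ι] {Ω : Type u}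
    [MeasurableSpace Ω] [StandardBorelSpace Ω] {s : ι → Ω → Ω}
    (hs : ∀ j, Function.Involutive (s j)) (μ : Measure Ω)
    [IsProbabilityMeasure μ] (hμ : ∀ j, MeasurePreserving (s j) μ μ)
    (huniq : ∀ j k x, s j x = s k x → s j x ≠ x → j = k) {D : ℕ}
    (hD : ∀ x, {j | s j x ≠ x}.encard ≤ D) :
    (Graphing.ofInvolutions hs μ hμ huniq hD).IsGeneratedBy s where
  measurePreserving := hμ
  involutive := hs
  eq_of_eq := huniq
  adj_iff _ _ := Iff.rfl

end Construction

/-! ### Clopen approximation, weak limits and convergence of ranks -/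

section Limit

universe u

/-- A measurable colouring of a totally disconnected compact space by finitely many colours is
continuous up to a set of small measure. -/
theorem exists_continuous_measureReal_ne_lt {K Y : Type*} [TopologicalSpace K] [CompactSpace K]
    [T2Space K] [SecondCountableTopology K] [TotallyDisconnectedSpace K] [MeasurableSpace K]
    [BorelSpace K] (μ : Measure K) [IsFiniteMeasure μ] [Fintype Y] [TopologicalSpace Y]
    [DiscreteTopology Y] [Nonempty Y] [MeasurableSpace Y] [DiscreteMeasurableSpace Y] {q : K → Y}
    (hq : Measurable q) {ε : ℝ} (hε : 0 < ε) :
    ∃ q' : K → Y, Continuous q' ∧ μ.real {x | q x ≠ q' x} < ε := by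
  classical
  have hring : IsSetRing {S : Set K | IsClopen S} :=
    ⟨isClopen_empty, fun _ _ => IsClopen.union, fun _ _ => IsClopen.diff⟩
  have hgen : (inferInstance : MeasurableSpace K) =
      MeasurableSpace.generateFrom {S : Set K | IsClopen S} := by
    rw [BorelSpace.measurable_eq (α := K)]
    exact isTopologicalBasis_isClopen.borel_eq_generateFrom
  let n : ℝ := Fintype.card Y
  have hn : 0 < n := Nat.cast_pos.2 Fintype.card_pos
  -- Clopen sets form a ring generating the Borel sets, so each colour class is approximated by a
  -- clopen set.
  have happ : ∀ y, ∃ S : Set K, IsClopen S ∧ μ (symmDiff S (q ⁻¹' {y})) < ENNReal.ofReal (ε / n) :=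
    fun y => exists_measure_symmDiff_lt_of_generateFrom_isSetRing hring
      ⟨{Set.univ}, Set.countable_singleton _, by simpa using isClopen_univ, by simp⟩ hgen
      (hq (MeasurableSet.of_discrete (s := {y}))) (by simp; positivity)
  choose S hS hSμ using happ
  -- The sets `S y` need not partition `K`: `g` decodes a membership vector with exactly one true
  -- entry and is arbitrary on the others.
  let g : (Y → Bool) → Y := fun p => if h : ∃ y, p = fun z => decide (y = z) then h.choose
    else Classical.arbitrary Y
  have hg : ∀ y, g (fun z => decide (y = z)) = y := by
    intro y
    have h : ∃ y', (fun z => decide (y = z)) = fun z => decide (y' = z) := ⟨y, rfl⟩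
    have h1 : g (fun z => decide (y = z)) = h.choose := dif_pos h
    have h2 := congrFun h.choose_spec h.choose
    rw [h1]
    exact (by simpa using h2 : y = h.choose).symm
  let p : K → Y → Bool := fun x z => decide (x ∈ S z)
  have hp : Continuous p := by
    refine continuous_pi fun z => ?_
    have : IsLocallyConstant fun x => decide (x ∈ S z) := by
      rw [IsLocallyConstant.iff_continuous]
      exact continuous_bool_rng true |>.2 (by simpa [Set.preimage] using hS z)
    exact this.continuous
  refine ⟨g ∘ p, continuous_of_discreteTopology.comp hp, ?_⟩
  have hsub : {x | q x ≠ (g ∘ p) x} ⊆ ⋃ y ∈ Finset.univ, symmDiff (S y) (q ⁻¹' {y}) := by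
    intro x hx
    by_contra hcon
    simp only [Finset.mem_univ, Set.iUnion_true, Set.mem_iUnion, not_exists, Set.mem_symmDiff,
      Set.mem_preimage, Set.mem_singleton_iff] at hcon
    refine hx ?_
    have : p x = fun z => decide (q x = z) := by
      ext z
      have := hcon z
      simp only [p, decide_eq_decide]
      tauto
    rw [Function.comp_apply, this, hg]
  have hlt : ∀ y, μ.real (symmDiff (S y) (q ⁻¹' {y})) < ε / n := fun y =>
    (ENNReal.lt_ofReal_iff_toReal_lt (measure_ne_top _ _)).1 (hSμ y)
  calc μ.real {x | q x ≠ (g ∘ p) x}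
      ≤ ∑ y, μ.real (symmDiff (S y) (q ⁻¹' {y})) :=
        (measureReal_mono hsub (measure_ne_top _ _)).trans (measureReal_biUnion_finset_le _ _)
    _ < ∑ _y : Y, ε / n := Finset.sum_lt_sum_of_nonempty Finset.univ_nonempty fun y _ => hlt y
    _ = ε := by
        rw [Finset.sum_const, nsmul_eq_mul, Finset.card_univ]
        exact mul_div_cancel₀ ε hn.ne'

namespace Compactification

variable {ι : Type} {V : ℕ → Type u} {a : ∀ i, ι → V i → V i} {C : Compactification a}

theorem isClopen_openWord {O : ι → Set C.K} (hO : ∀ j, IsClopen (O j)) (w : List ι) :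
    IsClopen {x | OpenWord C.s O w x} := by
  induction w with
  | nil => exact isClopen_univ
  | cons j w ih => exact (hO j).inter (ih.preimage (C.continuous_s j))

theorem eventually_mem_iff {K : Type*} [TopologicalSpace K] {S : Set K} (hS : IsClopen S) (x : K) :
    ∀ᶠ y in 𝓝 x, (y ∈ S ↔ x ∈ S) := by
  by_cases hx : x ∈ S
  · filter_upwards [hS.2.mem_nhds hx] with y hy using iff_of_true hy hx
  · filter_upwards [hS.compl.2.mem_nhds hx] with y hy using iff_of_false hy hx

/-- The map `C.π i` is equivariant and neither creates nor destroys coincidences of words. -/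
theorem ncard_clusterBall_π (O : ι → Set C.K) (r i : ℕ) (v : V i) :
    (clusterBall (a i) (fun j => C.π i ⁻¹' O j) r v).ncard =
      (clusterBall C.s O r (C.π i v)).ncard :=
  ncard_clusterBall_congr
    (fun w _ => openWord_map (C.map_s i) (fun _ _ => Iff.rfl) w v)
    fun w w' _ _ => (C.wordAct_eq_iff i v w w').symm

theorem isLocallyConstant_ncard_clusterBall [Finite ι] {O : ι → Set C.K} (hO : ∀ j, IsClopen (O j)) (r : ℕ) :
    IsLocallyConstant fun x => (clusterBall C.s O r x).ncard := by
  rw [IsLocallyConstant.iff_eventually_eq]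
  intro x
  have hfin : {w : List ι | w.length ≤ r}.Finite := List.finite_length_le ι r
  have h1 := (eventually_all_finite hfin).2 fun w _ =>
    eventually_mem_iff (isClopen_openWord hO w) x
  have h2 := (eventually_all_finite hfin).2 fun w _ => (eventually_all_finite hfin).2 fun w' _ =>
    eventually_mem_iff (C.isClopen_eq w w') x
  filter_upwards [h1, h2] with y hy1 hy2
  exact ncard_clusterBall_congr hy1 fun w w' hw hw' => hy2 w hw w' hw'

variable [∀ i, MeasurableSpace (V i)] [∀ i, DiscreteMeasurableSpace (V i)] {ν : ∀ i, Measure (V i)}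
  [∀ i, IsProbabilityMeasure (ν i)] {U : Ultrafilter ℕ}

/-- Along an ultrafilter, the images of the measures `ν i` in the compactification have a weak
limit. -/
theorem exists_limit_measure (hν : ∀ i j, MeasurePreserving (a i j) (ν i) (ν i)) :
    ∃ μ : Measure C.K, IsProbabilityMeasure μ ∧ (∀ j, MeasurePreserving (C.s j) μ μ) ∧
      ∀ f : C.K → ℝ, Continuous f →
        Tendsto (fun i => ∫ v, f (C.π i v) ∂ν i) U (𝓝 (∫ x, f x ∂μ)) := by
  have hπ : ∀ i, Measurable (C.π i) := fun i => Measurable.of_discrete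
  have hprob : ∀ i, IsProbabilityMeasure ((ν i).map (C.π i)) := fun i =>
    Measure.isProbabilityMeasure_map (hπ i).aemeasurable
  let m : ℕ → ProbabilityMeasure C.K := fun i => ⟨(ν i).map (C.π i), hprob i⟩
  -- The probability measures on the compact space form a compact space, so the ultrafilter
  -- converges.
  let μ : ProbabilityMeasure C.K := (U.map m).lim
  have hlim : Tendsto m U (𝓝 μ) := (U.map m).le_nhds_lim
  refine ⟨μ, inferInstance, fun j => ⟨(C.continuous_s j).measurable, ?_⟩, fun f hf => ?_⟩
  · have h1 := ProbabilityMeasure.tendsto_map_of_tendsto_of_continuous m μ hlim (C.continuous_s j)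
    have h2 : ∀ i, (m i).map (C.continuous_s j).measurable.aemeasurable = m i := by
      intro i
      refine Subtype.ext ?_
      change ((ν i).map (C.π i)).map (C.s j) = (ν i).map (C.π i)
      rw [Measure.map_map (C.continuous_s j).measurable (hπ i)]
      have h3 : C.s j ∘ C.π i = C.π i ∘ a i j := funext fun v => (C.map_s i j v).symm
      rw [h3, ← Measure.map_map (hπ i) (hν i j).measurable, (hν i j).map_eq]
    simp only [h2] at h1
    have h4 : μ.map (C.continuous_s j).measurable.aemeasurable = μ := tendsto_nhds_unique h1 hlim
    exact congrArg (fun m : ProbabilityMeasure C.K => (m : Measure C.K)) h4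
  · have h := ProbabilityMeasure.tendsto_iff_forall_integral_tendsto.1 hlim
      (BoundedContinuousFunction.mkOfCompact ⟨f, hf⟩)
    refine h.congr fun i => ?_
    change ∫ x, f x ∂((ν i).map (C.π i)) = _
    exact integral_map (hπ i).aemeasurable hf.aestronglyMeasurable

/-- Ball ranks are integrals of continuous functions and hence converge; they differ from cluster
ranks by at most `1 / (r + 1)`, uniformly in `i`. -/
theorem tendsto_clusterRank [Finite ι] [∀ i, MeasurableEq (V i)] {μ : Measure C.K} [IsProbabilityMeasure μ]
    (hμ : ∀ f : C.K → ℝ, Continuous f →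
      Tendsto (fun i => ∫ v, f (C.π i v) ∂ν i) U (𝓝 (∫ x, f x ∂μ)))
    {O : ι → Set C.K} (hO : ∀ j, IsClopen (O j)) :
    Tendsto (fun i => clusterRank (a i) (fun j => C.π i ⁻¹' O j) (ν i)) U
      (𝓝 (clusterRank C.s O μ)) := by
  rw [Metric.tendsto_nhds]
  intro ε hε
  obtain ⟨r, hr⟩ := exists_nat_one_div_lt (show 0 < ε / 3 by positivity)
  rw [one_div] at hr
  have hcont : Continuous fun x => 1 - ((clusterBall C.s O r x).ncard : ℝ)⁻¹ :=
    ((isLocallyConstant_ncard_clusterBall hO r).comp fun n : ℕ => 1 - (n : ℝ)⁻¹).continuous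
  have hball : Tendsto (fun i => ballRank (a i) (fun j => C.π i ⁻¹' O j) r (ν i)) U
      (𝓝 (ballRank C.s O r μ)) := by
    refine (hμ _ hcont).congr fun i => ?_
    simp only [ballRank, ncard_clusterBall_π]
  filter_upwards [Metric.tendsto_nhds.1 hball (ε / 3) (by positivity)] with i hi
  have h1 := abs_clusterRank_sub_ballRank_le (μ := ν i) (s := a i) (O := fun j => C.π i ⁻¹' O j)
    (fun j => Measurable.of_discrete) (fun j => MeasurableSet.of_discrete) r
  have h2 := abs_clusterRank_sub_ballRank_le (μ := μ) (fun j => (C.continuous_s j).measurable)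
    (fun j => (hO j).1.measurableSet) r
  rw [Real.dist_eq, abs_lt] at hi ⊢
  rw [abs_le] at h1 h2
  constructor <;> linarith [h1.1, h1.2, h2.1, h2.2, hi.1, hi.2]

end Compactification

end Limit

/-! ### Colourings on the compactification -/

section LimitColouring

universe u

variable {ι : Type} {V : ℕ → Type u} {a : ∀ i, ι → V i → V i} {C : Compactification a}

namespace Compactification

theorem isClopen_colouredSteps {X : Type*} [TopologicalSpace X] [DiscreteTopology X]
    {c : C.K → ι → X} (hc : ∀ j, Continuous fun x => c x j) (A : Set X) (j : ι) :
    IsClopen (colouredSteps C.s c A j) :=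
  (C.isClopen_eq_self j).compl.inter ((isClopen_discrete A).preimage (hc j))

theorem preimage_colouredSteps {X : Type*} (c : C.K → ι → X) (A : Set X) (i : ℕ) (j : ι) :
    C.π i ⁻¹' colouredSteps C.s c A j = colouredSteps (a i) (fun v => c (C.π i v)) A j := by
  ext v
  exact and_congr (not_congr (C.s_eq_self_iff i v j)) Iff.rfl

theorem colour_symm_of_π {X : Type*} [TopologicalSpace X] [DiscreteTopology X] {c : C.K → ι → X}
    (hc : ∀ j, Continuous fun x => c x j)
    (h : ∀ i v j, a i j v ≠ v → c (C.π i (a i j v)) j = c (C.π i v) j) (x : C.K) (j : ι)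
    (hx : C.s j x ≠ x) : c (C.s j x) j = c x j := by
  revert hx
  refine C.dense {x | C.s j x ≠ x → c (C.s j x) j = c x j} ?_ ?_ x
  · have : {x | C.s j x ≠ x → c (C.s j x) j = c x j} =
        {x | C.s j x = x} ∪ {x | c (C.s j x) j = c x j} := by
      ext x
      simp only [Set.mem_ofPred_eq, Set.mem_union]
      tauto
    rw [this]
    exact (C.isClopen_eq_self j).1.union
      (_root_.isClosed_eq ((hc j).comp (C.continuous_s j)) (hc j))
  · intro i v hv
    rw [← C.map_s]
    exact h i v j fun h' => hv ((C.s_eq_self_iff i v j).2 h')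

/-- A symmetric measurable colouring of the steps can be replaced by a continuous one at the cost of
a small change of the cluster ranks. -/
theorem exists_continuous_colouring [Fintype ι] {μ : Measure C.K} [IsProbabilityMeasure μ]
    (hinv : ∀ j, Function.Involutive (C.s j)) (hs : ∀ j, MeasurePreserving (C.s j) μ μ) {k : ℕ}
    {c : C.K → ι → Fin (k + 1)} (hcm : ∀ j, Measurable fun x => c x j)
    (hc : ∀ x j, C.s j x ≠ x → c (C.s j x) j = c x j) {ε : ℝ} (hε : 0 < ε) :
    ∃ c' : C.K → ι → Fin (k + 1), (∀ j, Continuous fun x => c' x j) ∧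
      (∀ x j, c' (C.s j x) j = c' x j) ∧ ∀ A : Set (Fin (k + 1)),
        |clusterRank C.s (colouredSteps C.s c A) μ - clusterRank C.s (colouredSteps C.s c' A) μ|
          < ε := by
  classical
  obtain ⟨δ, hδ, hrank⟩ := exists_abs_clusterRank_sub_lt hs hε
  let n : ℝ := Fintype.card ι
  have hn : 0 ≤ n := Nat.cast_nonneg _
  obtain ⟨q, hq, hqμ⟩ := exists_continuous_measureReal_ne_lt μ (measurable_pi_lambda c hcm)
    (show 0 < δ / (1 + n) by positivity)
  have hqj : ∀ j, Continuous fun x => q x j := fun j => (continuous_apply j).comp hq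
  -- The minimum restores symmetry. Where `q` agrees with `c` at both ends of a moving step, both
  -- entries equal `c x j`.
  let c' : C.K → ι → Fin (k + 1) := fun x j => min (q x j) (q (C.s j x) j)
  have hc' : ∀ j, Continuous fun x => c' x j := fun j =>
    (hqj j).min ((hqj j).comp (C.continuous_s j))
  refine ⟨c', hc', fun x j => ?_, fun A => ?_⟩
  · simp only [c', hinv j x]
    exact min_comm _ _
  let B₀ : Set C.K := {x | c x ≠ q x}
  have hB₀ : MeasurableSet B₀ :=
    (measurableSet_eq_fun (measurable_pi_lambda c hcm) hq.measurable).compl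
  -- Points that are bad or have a bad neighbour: at most `1 + n` times the measure of `B₀`, hence
  -- the choice `δ / (1 + n)`.
  let B : Set C.K := B₀ ∪ ⋃ j ∈ Finset.univ, C.s j ⁻¹' B₀
  have hB : MeasurableSet B :=
    hB₀.union (Finset.measurableSet_biUnion _ fun j _ => (hs j).measurable hB₀)
  refine hrank _ _ (measurableSet_colouredSteps (fun j => (hs j).measurable) hcm A)
    (fun j => (isClopen_colouredSteps hc' A j).1.measurableSet) B hB ?_ ?_
  · intro x hx j
    simp only [B, B₀, Finset.mem_univ, Set.iUnion_true, Set.mem_union, Set.mem_iUnion,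
      Set.mem_preimage, Set.mem_ofPred_eq, not_or, not_exists, not_not] at hx
    refine and_congr_right fun hne => ?_
    have : c' x j = c x j := by
      simp only [c', ← hx.1, ← hx.2 j, hc x j hne, min_self]
    rw [this]
  · have h1 : μ.real (⋃ j ∈ Finset.univ, C.s j ⁻¹' B₀) ≤ n * μ.real B₀ := by
      refine (measureReal_biUnion_finset_le _ _).trans (le_of_eq ?_)
      simp only [(hs _).measureReal_preimage hB₀.nullMeasurableSet, Finset.sum_const, nsmul_eq_mul,
        Finset.card_univ, n]
    calc μ.real B ≤ μ.real B₀ + n * μ.real B₀ :=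
          (measureReal_union_le _ _).trans (by gcongr)
      _ = (1 + n) * μ.real B₀ := by ring
      _ < (1 + n) * (δ / (1 + n)) := by gcongr
      _ = δ := by field_simp

variable [∀ i, MeasurableSpace (V i)] [∀ i, DiscreteMeasurableSpace (V i)] {ν : ∀ i, Measure (V i)}
  [∀ i, IsProbabilityMeasure (ν i)] {U : Ultrafilter ℕ}

theorem tendsto_clusterRank_colouredSteps [Finite ι] [∀ i, MeasurableEq (V i)] {μ : Measure C.K}
    [IsProbabilityMeasure μ]
    (hμ : ∀ f : C.K → ℝ, Continuous f →
      Tendsto (fun i => ∫ v, f (C.π i v) ∂ν i) U (𝓝 (∫ x, f x ∂μ)))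
    {X : Type*} [TopologicalSpace X] [DiscreteTopology X] {c : C.K → ι → X}
    (hc : ∀ j, Continuous fun x => c x j) (A : Set X) :
    Tendsto (fun i => clusterRank (a i) (colouredSteps (a i) (fun v => c (C.π i v)) A) (ν i)) U
      (𝓝 (clusterRank C.s (colouredSteps C.s c A) μ)) := by
  refine (tendsto_clusterRank hμ (isClopen_colouredSteps hc A)).congr fun i => ?_
  congr 1
  exact funext fun j => preimage_colouredSteps c A i j

end Compactification

end LimitColouring

/-! ### Points of Hausdorff limits -/

section Hausdorff

open Metric

theorem exists_tendsto_of_tendsto_hausdorffEDist {E : Type*} [PseudoEMetricSpace E]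
    {Q : ℕ → Set E} {A : Set E} (h : Tendsto (fun i => hausdorffEDist (Q i) A) atTop (𝓝 0))
    (hQ : ∀ i, (Q i).Nonempty) (hfin : ∀ x y : E, edist x y ≠ ⊤) {x : E} (hx : x ∈ A) :
    ∃ u : ℕ → E, (∀ i, u i ∈ Q i) ∧ Tendsto u atTop (𝓝 x) := by
  -- The infimum may not be attained, hence the vanishing slack.
  have hex : ∀ i : ℕ, ∃ y ∈ Q i, edist x y < infEDist x (Q i) + ((i : ℝ≥0∞) + 1)⁻¹ := by
    intro i
    refine infEDist_lt_iff.1 (ENNReal.lt_add_right ?_ (by simp))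
    obtain ⟨y, hy⟩ := hQ i
    exact ne_top_of_le_ne_top (hfin x y) (infEDist_le_edist_of_mem hy)
  choose u hu hlt using hex
  refine ⟨u, hu, tendsto_iff_edist_tendsto_0.2 ?_⟩
  have hz : Tendsto (fun i : ℕ => hausdorffEDist (Q i) A + ((i : ℝ≥0∞) + 1)⁻¹) atTop (𝓝 0) := by
    have h1 : Tendsto (fun i : ℕ => ((i : ℝ≥0∞) + 1)⁻¹) atTop (𝓝 0) := by
      have := (tendsto_add_atTop_iff_nat 1).2 ENNReal.tendsto_inv_nat_nhds_zero
      simpa using this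
    simpa using h.add h1
  refine tendsto_of_tendsto_of_tendsto_of_le_of_le tendsto_const_nhds hz (fun _ => zero_le)
    fun i => ?_
  rw [edist_comm]
  refine (hlt i).le.trans ?_
  gcongr
  rw [hausdorffEDist_comm]
  exact infEDist_le_hausdorffEDist_of_mem hx

theorem mem_closure_of_tendsto_hausdorffEDist {E : Type*} [PseudoEMetricSpace E] {F : Filter ℕ}
    [F.NeBot] {Q : ℕ → Set E} {A : Set E} (h : Tendsto (fun i => hausdorffEDist (Q i) A) F (𝓝 0))
    {u : ℕ → E} (hu : ∀ i, u i ∈ Q i) {x : E} (hx : Tendsto u F (𝓝 x)) : x ∈ closure A := by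
  rw [mem_closure_iff_infEDist_zero]
  have h1 : ∀ i, infEDist x A ≤ edist (u i) x + hausdorffEDist (Q i) A := by
    intro i
    rw [add_comm, edist_comm]
    exact infEDist_le_infEDist_add_edist.trans
      (add_le_add_left (infEDist_le_hausdorffEDist_of_mem (hu i)) _)
  have h2 := (tendsto_iff_edist_tendsto_0.1 hx).add h
  rw [add_zero] at h2
  exact nonpos_iff_eq_zero.1 (ge_of_tendsto' h2 h1)

end Hausdorff

/-! ### The limit graphing -/

section LimitGraphing

universe u

theorem quotientSet_succ_nonempty {J : Type*} [MeasurableSpace J] (k : ℕ) (φ : Set J → ℝ) :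
    (quotientSet (k + 1) φ).Nonempty :=
  ⟨WithLp.toLp 2 fun A => φ ((fun _ => 0) ⁻¹' (A : Set (Fin (k + 1)))), fun _ => 0,
    measurable_const, fun _ => rfl⟩

theorem EuclideanSpace.tendsto_of_apply {α κ : Type*} [Fintype κ] {F : Filter α}
    {u : α → EuclideanSpace ℝ κ} {x : EuclideanSpace ℝ κ}
    (h : ∀ j, Tendsto (fun i => u i j) F (𝓝 (x j))) : Tendsto u F (𝓝 x) :=
  ((PiLp.continuous_toLp 2 fun _ : κ => ℝ).tendsto x.ofLp).comp (tendsto_pi_nhds.2 h)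

/-- Limits of quotient convergent sequences of finite graphs generated by involutions. -/
theorem exists_limit_graphing {Γ : ℕ → Graphing.{u}} [∀ i, Finite (Γ i).Ω]
    [∀ i, DiscreteMeasurableSpace (Γ i).Ω] {ι : Type} [Fintype ι] {a : ∀ i, ι → (Γ i).Ω → (Γ i).Ω}
    (hΓ : ∀ i, (Γ i).IsGeneratedBy (a i)) {D : ℕ}
    (hD : ∀ i x, ((Γ i).graph.neighborSet x).encard ≤ D)
    (hconv : QuotientConvergent fun i => (Γ i).rank) :
    ∃ H : Graphing.{0}, (∀ x, (H.graph.neighborSet x).encard ≤ D) ∧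
      QuotientConvergesTo (fun i => (Γ i).rank) H.rank := by
  choose! A hA using hconv
  replace hA := fun k : ℕ => hA (k + 1) (by lia)
  have hAne : ∀ k, (A (k + 1)).Nonempty := by
    intro k
    obtain ⟨i, hi⟩ := ((hA k).eventually_lt_const ENNReal.zero_lt_top).exists
    exact Metric.nonempty_of_hausdorffEDist_ne_top (quotientSet_succ_nonempty k _) hi.ne
  have : ∀ k, Nonempty (A (k + 1)) := fun k => (hAne k).to_subtype
  -- Only countably many points can be encoded as labels, so a dense sequence of each limit set is
  -- lifted to the finite graphs.
  have happ : ∀ k n : ℕ, ∃ u : ℕ → EuclideanSpace ℝ (Finset (Fin (k + 1))),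
      (∀ i, u i ∈ quotientSet (k + 1) (Γ i).rank) ∧
      Tendsto u atTop (𝓝 (TopologicalSpace.denseSeq (A (k + 1)) n : EuclideanSpace ℝ _)) :=
    fun k n => exists_tendsto_of_tendsto_hausdorffEDist (hA k)
      (fun i => quotientSet_succ_nonempty k _) edist_ne_top (Subtype.coe_prop _)
  choose u hu hulim using happ
  have hu' := fun k n i => (hΓ i).mem_quotientSet_iff.1 (hu k n i)
  choose c _ hc hcu using hu'
  choose col hcol using fun (i : ℕ) (w w' : List ι) =>
    exists_colouring_wordAct (fun j => ((hΓ i).involutive j).bijective) w w'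
  -- Left labels are three-colourings separating a pair of words; right labels are the lifted
  -- colourings, one for each `k`, dense point and generator.
  let m : (List ι × List ι) ⊕ (ℕ × ℕ × ι) → ℕ := Sum.elim (fun _ => 2) fun p => p.1
  let lab : ∀ l i, (Γ i).Ω → Fin (m l + 1) := fun l => match l with
    | Sum.inl p => fun i v => col i p.1 p.2 v
    | Sum.inr p => fun i v => c p.1 p.2.1 i v p.2.2
  obtain ⟨C, hC⟩ := exists_compactification a lab fun w w' =>
    ⟨{Sum.inl (w, w')}, Set.finite_singleton _, fun i v h =>
      by_contra fun hne => hcol i w w' v hne (h _ rfl)⟩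
  have hinv := C.involutive_s fun i => (hΓ i).involutive
  have huniq : ∀ j k x, C.s j x = C.s k x → C.s j x ≠ x → j = k := fun j k x =>
    C.eq_of_s_eq fun i => (hΓ i).eq_of_eq
  have hdeg : ∀ x, {j | C.s j x ≠ x}.encard ≤ D := by
    refine C.encard_active_le fun i v => ?_
    have hinj : Set.InjOn (fun j => a i j v) {j | a i j v ≠ v} := fun j hj k _ hjk =>
      (hΓ i).eq_of_eq j k v hjk hj
    rw [← hinj.encard_image]
    refine (Set.encard_le_encard ?_).trans (hD i v)
    rintro _ ⟨j, hj, rfl⟩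
    exact (hΓ i).adj j hj
  -- Limits along `U` suffice: the whole sequence of quotient sets already converges to `A`, so only
  -- the closure of `A` has to be identified.
  let U : Ultrafilter ℕ := hyperfilter ℕ
  have hU : (U : Filter ℕ) ≤ atTop := Nat.hyperfilter_le_atTop
  obtain ⟨μ, hμp, hμs, hμ⟩ := C.exists_limit_measure (U := U) (ν := fun i => (Γ i).μ)
    fun i => (hΓ i).measurePreserving
  have hH := Graphing.isGeneratedBy_ofInvolutions hinv μ hμs huniq hdeg
  refine ⟨Graphing.ofInvolutions hinv μ hμs huniq hdeg,
    fun x => encard_neighborSet_involutionGraph_le hinv (hdeg x), fun k hk => ?_⟩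
  obtain ⟨k, rfl⟩ : ∃ k', k = k' + 1 := ⟨k - 1, by lia⟩
  suffices h : closure (quotientSet (k + 1) (Graphing.ofInvolutions hinv μ hμs huniq hdeg).rank) =
      closure (A (k + 1)) by
    refine (hA k).congr fun i => ?_
    rw [← Metric.hausdorffEDist_closure_right, ← h, Metric.hausdorffEDist_closure_right]
  refine Set.Subset.antisymm (closure_minimal ?_ isClosed_closure)
    (closure_minimal ?_ isClosed_closure)
  · intro x hx
    obtain ⟨c, hcm, hcs, hcx⟩ := hH.mem_quotientSet_iff.1 hx
    choose c' hc' hcs' hcr using fun n : ℕ =>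
      Compactification.exists_continuous_colouring hinv hμs hcm hcs (Nat.one_div_pos_of_nat (n := n))
    refine isClosed_closure.mem_of_tendsto (b := atTop) (f := fun n => WithLp.toLp 2
      fun S : Finset (Fin (k + 1)) => clusterRank C.s (colouredSteps C.s (c' n) S) μ)
      (EuclideanSpace.tendsto_of_apply fun S => ?_) (Eventually.of_forall fun n => ?_)
    · rw [tendsto_iff_dist_tendsto_zero]
      refine squeeze_zero (fun _ => dist_nonneg) (fun n => ?_)
        (tendsto_one_div_add_atTop_nhds_zero_nat (𝕜 := ℝ))
      rw [dist_comm, hcx S]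
      exact (hcr n S).le
    · refine mem_closure_of_tendsto_hausdorffEDist ((hA k).mono_left hU) (u := fun i => WithLp.toLp 2
        fun S : Finset (Fin (k + 1)) =>
          clusterRank (a i) (colouredSteps (a i) (fun v => c' n (C.π i v)) S) (Γ i).μ)
        (fun i => (hΓ i).mem_quotientSet_iff.2 ⟨fun v => c' n (C.π i v),
          fun j => Measurable.of_discrete, fun v j _ => ?_, fun S => rfl⟩)
        (EuclideanSpace.tendsto_of_apply fun S =>
          Compactification.tendsto_clusterRank_colouredSteps hμ (hc' n) (S : Set (Fin (k + 1))))
      simp only [C.map_s, hcs']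
  -- Each dense point is attained exactly: its labels extend continuously to `K`, and the ranks of
  -- this colouring are the limits of the `u k n i`.
  · have hsub : Set.range (fun n => (TopologicalSpace.denseSeq (A (k + 1)) n :
        EuclideanSpace ℝ (Finset (Fin (k + 1))))) ⊆
        quotientSet (k + 1) (Graphing.ofInvolutions hinv μ hμs huniq hdeg).rank := by
      rintro _ ⟨n, rfl⟩
      choose f hf hfπ using fun j => hC (Sum.inr (k, n, j))
      let c' : C.K → ι → Fin (k + 1) := fun x j => f j x
      have hc'f : ∀ j, Continuous fun x => c' x j := hf
      have hc'π : ∀ i v, c' (C.π i v) = c k n i v := fun i v => funext fun j => hfπ j i v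
      refine hH.mem_quotientSet_iff.2 ⟨c', fun j => (hc'f j).measurable, fun x j hx =>
        Compactification.colour_symm_of_π hc'f (fun i v j hv => ?_) x j hx, fun S => ?_⟩
      · rw [hc'π, hc'π]
        exact hc k n i v j hv
      · have h1 := Compactification.tendsto_clusterRank_colouredSteps hμ hc'f
          (S : Set (Fin (k + 1)))
        simp only [hc'π, ← hcu k n] at h1
        have h2 : Tendsto (fun i => u k n i S) U (𝓝 ((TopologicalSpace.denseSeq (A (k + 1)) n :
            EuclideanSpace ℝ (Finset (Fin (k + 1)))) S)) :=
          (((PiLp.continuous_apply 2 (fun _ => ℝ) S).tendsto _).comp (hulim k n)).mono_left hU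
        exact tendsto_nhds_unique h2 h1
    intro x hx
    refine closure_mono hsub ?_
    have h := closure_subtype.1 (TopologicalSpace.denseRange_denseSeq (A (k + 1)) ⟨x, hx⟩)
    rwa [← Set.range_comp] at h

end LimitGraphing

theorem theorem1p3 (D : ℕ) (hD : 1 ≤ D) (V : ℕ → Type*) [∀ i, Fintype (V i)] [∀ i, Nonempty (V i)]
    (G : ∀ i, SimpleGraph (V i)) (hconn : ∀ i, (G i).Connected)
    (hdeg : ∀ i x, ((G i).neighborSet x).encard ≤ D)
    (hconv : QuotientConvergent (fun i => (G i).toGraphing.rank)) :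
    ∃ H : Graphing.{0}, (∀ x, (H.graph.neighborSet x).encard ≤ D) ∧
      QuotientConvergesTo (fun i => (G i).toGraphing.rank) H.rank := by
  choose a hinv hadj huniq using fun i => (G i).exists_involutions (hdeg i)
  have : ∀ i, Finite (G i).toGraphing.Ω := fun i => inferInstanceAs (Finite (V i))
  have : ∀ i, DiscreteMeasurableSpace (G i).toGraphing.Ω := fun i => ⟨fun _ => trivial⟩
  exact exists_limit_graphing
    (fun i => (G i).toGraphing_isGeneratedBy (hinv i) (huniq i) (hadj i)) hdeg hconv
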